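/- Let $k$ be an algebraically closed field of characteristic zero and let $L$ be a finite-dimensional Lie algebra over $k$ with basis $x_1,\dots,x_n$. Notation. The index of $L$ is $i(L)=\min_{\xi\in L^*}\dim\{x\in L:\xi([x,y])=0\ \forall y\in L\}$, the magic number is $c(L)=\tfrac12(\dim L+i(L))$, and $\alpha(L)$ is the maximal dimension of an abelian subalgebra of $L$. A commutative polarization (CP) of $L$ is an abelian subalgebra of dimension $c(L)$; $L$ has the $R$-property if it has a CP or an abelian subalgebra of dimension $c(L)-1$. The symmetric algebra $S(L)=k[x_1,\dots,x_n]$ carries the Poisson bracket $\{f,g\}=\sum_{i,j}[x_i,x_j]\frac{\partial f}{\partial x_i}\frac{\partial g}{\partial x_j}$, with Poisson center $Y(L)$. A Poisson commutative subalgebra $M\subseteq S(L)$ is complete if $\operatorname{trdeg}_k M=c(L)$. Milovanov's conjecture holds for $L$ if $S(L)$ has a complete Poisson commutative subalgebra generated by elements of degree at most two. The types are given by the following brackets $[x_i,x_j]$, $i<j$, all others being zero. * $L_n$ ($n\ge 3$): $[x_1,x_j]=x_{j+1}$ for $2\le j\le n-1$. * $Q_n$ ($n=2q$, $q\ge 3$):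 $[x_1,x_j]=x_{j+1}$ for $2\le j\le n-2$, and $[x_j,x_{n-j+1}]=(-1)^{j+1}x_n$ for $2\le j\le q$. * $R_n$ ($n\ge 5$): $[x_1,x_j]=x_{j+1}$ for $2\le j\le n-1$, and $[x_2,x_j]=x_{j+2}$ for $3\le j\le n-2$. * $W_n$ ($n\ge 3$): $[x_1,x_j]=x_{j+1}$ for $2\le j\le n-1$, and $[x_i,x_j]=\frac{6\,(i-2)!\,(j-2)!\,(j-i)}{(i+j-2)!}\,x_{i+j}$ for $2\le i<j$, $i+j\le n$. **Theorem 8.6.** If $L$ is of one of the types $L_n,Q_n,R_n,W_n$, then $L$ has the $R$-property and Milovanov's conjecture holds for $L$. If $L$ is of type $L_n$, $R_n$ or $W_n$, then $L$ admits a CP. Moreover $$\alpha(L_n)=n-1,\qquad \alpha(Q_n)=\tfrac n2,\qquad \alpha(R_n)=n-2,\qquad \alpha(W_n)=\Big[\tfrac{n+2}{2}\Big].$$ For type $Q_n$, the span $H=\langle x_{q+1},\dots,x_n\rangle$ is an abelian subalgebra of dimension $c(L)-1$, and the subalgebra $S(H)Y(L)$ of $S(L)$ generated by $H$ and $Y(L)$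 satisfies $$S(H)Y(L)=k[x_{q+1},\dots,x_n,f],\qquad f=2x_1x_n+(-1)^{q+1}x_{q+1}^2+2\sum_{i=3}^{q}(-1)^i x_ix_{n-i+2},$$ where $f$ is homogeneous of degree two; $S(H)Y(L)$ is a complete Poisson commutative subalgebra of $S(L)$ generated by elements of degree at most two. -/

import Mathlib

open scoped Nat

noncomputable section

namespace Filiform

/-! ### Index, magic number, abelian subalgebras -/

section Invariants

variable (k : Type*) [Field k] (L : Type*) [LieRing L] [LieAlgebra k L]

/-- The stabilizer `L(ξ) = {x | ξ [x, y] = 0 for all y}` of a linear functional `ξ`. -/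
def stabilizer (ξ : Module.Dual k L) : Submodule k L where
  carrier := {x | ∀ y : L, ξ ⁅x, y⁆ = 0}
  add_mem' := by
    intro a c ha hc y
    rw [add_lie, map_add, ha y, hc y, add_zero]
  zero_mem' := by
    intro y
    rw [zero_lie, map_zero]
  smul_mem' := by
    intro t a ha y
    rw [smul_lie, map_smul, ha y, smul_zero]

/-- The index `i(L)`: the minimal dimension of a stabilizer `L(ξ)`, `ξ ∈ L*`. -/
def index : ℕ := sInf (Set.range fun ξ : Module.Dual k L => Module.finrank k (stabilizer k L ξ))

/-- The magic number `c(L) = (dim L + i(L)) / 2`; the division is exact because the alternating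
form `(x, y) ↦ ξ [x, y]` has even rank `dim L - dim L(ξ)`. -/
def magicNumber : ℕ := (Module.finrank k L + index k L) / 2

/-- The maximal abelian dimension `α(L)` of a finite dimensional Lie algebra. -/
def maxAbelianDim : ℕ :=
  sSup {d | ∃ A : LieSubalgebra k L, IsLieAbelian A ∧ Module.finrank k A = d}

/-- `L` admits a commutative polarization: an abelian subalgebra of dimension `c(L)`. -/
def HasCommutativePolarization : Prop :=
  ∃ P : LieSubalgebra k L, IsLieAbelian P ∧ Module.finrank k P = magicNumber k L

/-- Rentschler's property: `L` admits a commutative polarization or an abelian subalgebra of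
dimension `c(L) - 1`. -/
def RProperty : Prop :=
  HasCommutativePolarization k L ∨
    ∃ H : LieSubalgebra k L, IsLieAbelian H ∧ Module.finrank k H + 1 = magicNumber k L

end Invariants

/-! ### The Poisson algebra `S(L)`, identified with `k[x₁, …, xₙ]` by a basis of `L` -/

section Poisson

variable {k : Type*} [Field k] {L : Type*} [LieRing L] [LieAlgebra k L]
variable {ι : Type*} [Fintype ι] (b : Module.Basis ι k L)

/-- The inclusion of `L` into `S(L)` as the space of linear forms, `b i ↦ X i`. -/
def toSym : L →ₗ[k] MvPolynomial ι k := b.constr k fun i => MvPolynomial.X i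

/-- The Poisson bracket `{f, g} = ∑ i, ∑ j, [xᵢ, xⱼ] (∂f/∂xᵢ) (∂g/∂xⱼ)` on `S(L)`. -/
def poissonBracket (f g : MvPolynomial ι k) : MvPolynomial ι k :=
  ∑ i, ∑ j, toSym b ⁅b i, b j⁆ * MvPolynomial.pderiv i f * MvPolynomial.pderiv j g

/-- The Poisson center `Y(L)` of `S(L)`. -/
def poissonCenter : Subalgebra k (MvPolynomial ι k) where
  carrier := {f | ∀ g, poissonBracket b f g = 0}
  mul_mem' := by
    intro f f' hf hf' g
    have h : poissonBracket b (f * f') g =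
        f * poissonBracket b f' g + f' * poissonBracket b f g := by
      simp only [poissonBracket, Finset.mul_sum, ← Finset.sum_add_distrib]
      refine Finset.sum_congr rfl fun i _ => Finset.sum_congr rfl fun j _ => ?_
      rw [Derivation.leibniz, smul_eq_mul, smul_eq_mul]
      ring
    rw [h, hf g, hf' g, mul_zero, mul_zero, add_zero]
  add_mem' := by
    intro f f' hf hf' g
    have h : poissonBracket b (f + f') g = poissonBracket b f g + poissonBracket b f' g := by
      simp only [poissonBracket, ← Finset.sum_add_distrib]
      refine Finset.sum_congr rfl fun i _ => Finset.sum_congr rfl fun j _ => ?_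
      rw [map_add]
      ring
    rw [h, hf g, hf' g, add_zero]
  algebraMap_mem' := by
    intro r g
    simp [poissonBracket]

/-- For a subspace `H` of `L`, the subalgebra `S(H)` of `S(L)` generated by `H`. -/
def symSub (H : Submodule k L) : Subalgebra k (MvPolynomial ι k) :=
  Algebra.adjoin k (toSym b '' (H : Set L))

/-- `M` is a Poisson commutative subalgebra of `S(L)`. -/
def IsPoissonCommutative (M : Subalgebra k (MvPolynomial ι k)) : Prop :=
  ∀ f ∈ M, ∀ g ∈ M, poissonBracket b f g = 0

/-- `M` is a complete Poisson commutative subalgebra of `S(L)`: its transcendence degree over `k`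
is the magic number `c(L)`. -/
def IsCompletePoissonCommutative (M : Subalgebra k (MvPolynomial ι k)) : Prop :=
  IsPoissonCommutative b M ∧ Algebra.trdeg k M = (magicNumber k L : Cardinal)

/-- `M` is generated, as a `k`-algebra, by elements of degree at most two. -/
def IsGeneratedInDegreeLETwo (M : Subalgebra k (MvPolynomial ι k)) : Prop :=
  ∃ G : Set (MvPolynomial ι k), (∀ g ∈ G, g.totalDegree ≤ 2) ∧ M = Algebra.adjoin k G

/-- The conclusion of Milovanov's conjecture for `L`: there is a complete Poisson commutative
subalgebra of `S(L)` generated by elements of degree at most two. -/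
def MilovanovHolds : Prop :=
  ∃ M : Subalgebra k (MvPolynomial ι k),
    IsCompletePoissonCommutative b M ∧ IsGeneratedInDegreeLETwo M

end Poisson

/-! ### The four types -/

section Types

variable {k : Type*} [Field k] {L : Type*} [LieRing L] [LieAlgebra k L]
variable {n : ℕ} (b : Module.Basis (Fin n) k L)

/-- The vectors `x₁, …, xₙ` of the basis `b`, numbered from `1`
(the value for other numbers is irrelevant, and set to `0`). -/
def vec (i : ℕ) : L :=
  if h : 1 ≤ i ∧ i ≤ n then b ⟨i - 1, by omega⟩ else 0

/-- Type `Lₙ`: `[x₁, xⱼ] = xⱼ₊₁` for `2 ≤ j ≤ n - 1`. In this and the next three definitions the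
brackets `[xᵢ, xⱼ]` with `i < j` that are not listed are zero. -/
def IsTypeL : Prop :=
  ∀ i j : ℕ, 1 ≤ i → i < j → j ≤ n →
    ⁅vec b i, vec b j⁆ = if i = 1 ∧ j ≤ n - 1 then vec b (j + 1) else 0

/-- Type `Qₙ` (`n = 2q`): `[x₁, xⱼ] = xⱼ₊₁` for `2 ≤ j ≤ n - 2` and
`[xᵢ, xₙ₋ᵢ₊₁] = (-1)ⁱ⁺¹ xₙ` for `2 ≤ i ≤ q`. -/
def IsTypeQ : Prop :=
  ∀ i j : ℕ, 1 ≤ i → i < j → j ≤ n →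
    ⁅vec b i, vec b j⁆ =
      if i = 1 ∧ j ≤ n - 2 then vec b (j + 1)
      else if 2 ≤ i ∧ i + j = n + 1 then ((-1 : k) ^ (i + 1)) • vec b n
      else 0

/-- Type `Rₙ`: `[x₁, xⱼ] = xⱼ₊₁` for `2 ≤ j ≤ n - 1` and `[x₂, xⱼ] = xⱼ₊₂` for
`3 ≤ j ≤ n - 2`. -/
def IsTypeR : Prop :=
  ∀ i j : ℕ, 1 ≤ i → i < j → j ≤ n →
    ⁅vec b i, vec b j⁆ =
      if i = 1 ∧ j ≤ n - 1 then vec b (j + 1)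
      else if i = 2 ∧ j ≤ n - 2 then vec b (j + 2)
      else 0

/-- Type `Wₙ`: `[x₁, xⱼ] = xⱼ₊₁` for `2 ≤ j ≤ n - 1` and
`[xᵢ, xⱼ] = (6 (i - 2)! (j - 2)! (j - i) / (i + j - 2)!) xᵢ₊ⱼ` for `2 ≤ i < j`, `i + j ≤ n`.
With `x₁ = e₁` and `xᵢ = 6 (i - 2)! eᵢ` for `i ≥ 2` this is the truncated Witt algebra
`[eᵢ, eⱼ] = (j - i) eᵢ₊ⱼ`, `i + j ≤ n`. -/
def IsTypeW : Prop :=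
  ∀ i j : ℕ, 1 ≤ i → i < j → j ≤ n →
    ⁅vec b i, vec b j⁆ =
      if i = 1 ∧ j ≤ n - 1 then vec b (j + 1)
      else if 2 ≤ i ∧ i + j ≤ n then
        ((6 * ((i - 2)! : k) * ((j - 2)! : k) * ((j : k) - (i : k))) / ((i + j - 2)! : k)) •
          vec b (i + j)
      else 0

/-- The linear form `xᵢ ∈ S(L)`. -/
def var (i : ℕ) : MvPolynomial (Fin n) k := toSym b (vec b i)

/-- The quadratic polynomial
`f = 2 x₁ xₙ + (-1)^(q+1) x_{q+1}² + 2 ∑_{i=3}^{q} (-1)^i xᵢ x_{n-i+2}`. -/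
def quadQ (q : ℕ) : MvPolynomial (Fin n) k :=
  2 * var b 1 * var b n + (-1) ^ (q + 1) * var b (q + 1) ^ 2 +
    2 * ∑ i ∈ Finset.Icc 3 q, (-1) ^ i * (var b i * var b (n - i + 2))

end Types

end Filiform

end

/-! For a functional `ξ`, let `B_ξ(x, y) = ξ [x, y]`; its radical is the stabilizer `L(ξ)`. A
`B_ξ`-isotropic subspace has dimension at most `(dim L + dim L(ξ)) / 2`, and an abelian subalgebra
is isotropic for every `ξ`. So an abelian `P` gives `i(L) ≥ 2 dim P - dim L`, and a single `ξ` with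
`dim L + dim L(ξ) ≤ 2 dim P` forces `c(L) = α(L) = dim P`. In types `L`, `R`, `W` the functional
`xₙ*` and a tail `P = ⟨x_s, …, xₙ⟩` of the basis do this, and `S(P)` is a polynomial ring on `c(L)`
linear forms.

In type `Q` the radical of `xₙ*` is at most `⟨x₁, xₙ⟩`. Every stabilizer has dimension at least 2:
it contains the central `xₙ`, and an alternating form on the odd-dimensional `⟨x₁, …, xₙ₋₁⟩` is
degenerate. Hence `c(L) = q + 1`. No abelian subalgebra reaches this dimension, so the missing
generator is the quadratic Casimir `f`.

It remains to see that `Y(L)` lies in `k[xₙ, f]`. Since `f = 2 x₁ xₙ + (terms without x₁)`,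
inverting `xₙ` lets `f` replace `x₁` as a coordinate, so for `g ∈ Y(L)` some `xₙ^N g` is a
polynomial in `f, x₂, …, xₙ`. Bracketing with `x_{n+1-m}` for `2 ≤ m ≤ n - 1` acts on it as `± xₙ
∂/∂x_m`, so only `f` and `xₙ` occur. Finally the powers of `xₙ` cancel inside `k[xₙ, f]`, because
`f` stays transcendental modulo `xₙ`. -/

noncomputable section

namespace Filiform

/-! ### Isotropic subspaces of the form `ξ [x, y]`, index and abelian dimension -/

section Isotropic

variable {k : Type*} [Field k] {L : Type*} [LieRing L] [LieAlgebra k L]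

/-- The bilinear form `(x, y) ↦ ξ [x, y]`, as a map from `L` to its dual. -/
def kirillovForm (ξ : Module.Dual k L) : L →ₗ[k] Module.Dual k L :=
  LinearMap.mk₂ k (fun x y => ξ ⁅x, y⁆) (by simp) (by simp) (by simp) (by simp)

theorem ker_kirillovForm (ξ : Module.Dual k L) :
    LinearMap.ker (kirillovForm ξ) = stabilizer k L ξ := by
  ext x
  rw [LinearMap.mem_ker, LinearMap.ext_iff]
  rfl

/-- The form maps `A` into the annihilator of `A`, with kernel inside the stabilizer; rank-nullity
gives the bound. -/
theorem two_mul_finrank_le_of_isotropic [FiniteDimensional k L] (ξ : Module.Dual k L) (A : Submodule k L)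
    (hA : ∀ x ∈ A, ∀ y ∈ A, ξ ⁅x, y⁆ = 0) :
    2 * Module.finrank k A ≤ Module.finrank k L + Module.finrank k (stabilizer k L ξ) := by
  set B := (kirillovForm ξ).domRestrict A
  have h1 := LinearMap.finrank_range_add_finrank_ker B
  have h2 : LinearMap.range B ≤ A.dualAnnihilator := by
    rintro _ ⟨x, rfl⟩
    rw [Submodule.mem_dualAnnihilator]
    exact fun y hy => hA x x.2 y hy
  have h3 : (LinearMap.ker B).map A.subtype ≤ stabilizer k L ξ := by
    rw [← ker_kirillovForm]
    rintro _ ⟨x, hx, rfl⟩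
    exact hx
  have h4 := Submodule.finrank_mono h2
  have h5 := Submodule.finrank_mono h3
  rw [Submodule.finrank_map_subtype_eq] at h5
  have h6 := Subspace.finrank_add_finrank_dualAnnihilator_eq A
  omega

theorem isotropic_of_abelian (A : LieSubalgebra k L) [IsLieAbelian A] (ξ : Module.Dual k L) :
    ∀ x ∈ A.toSubmodule, ∀ y ∈ A.toSubmodule, ξ ⁅x, y⁆ = 0 := by
  intro x hx y hy
  have h : ⁅(⟨x, hx⟩ : A), (⟨y, hy⟩ : A)⁆ = 0 := trivial_lie_zero _ _ _ _
  have h' : ⁅x, y⁆ = 0 := by simpa using congrArg (Subtype.val) h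
  rw [h', map_zero]

theorem index_le (ξ : Module.Dual k L) : index k L ≤ Module.finrank k (stabilizer k L ξ) :=
  Nat.sInf_le ⟨ξ, rfl⟩

theorem le_index {m : ℕ} (h : ∀ ξ : Module.Dual k L, m ≤ Module.finrank k (stabilizer k L ξ)) :
    m ≤ index k L :=
  le_csInf (Set.range_nonempty _) (by rintro _ ⟨ξ, rfl⟩; exact h ξ)

theorem maxAbelianDim_eq (P : LieSubalgebra k L) (hP : IsLieAbelian P)
    (h : ∀ A : LieSubalgebra k L, IsLieAbelian A → Module.finrank k A ≤ Module.finrank k P) :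
    maxAbelianDim k L = Module.finrank k P := by
  refine le_antisymm (csSup_le ⟨_, P, hP, rfl⟩ ?_) (le_csSup ⟨Module.finrank k P, ?_⟩ ⟨P, hP, rfl⟩)
  · rintro _ ⟨A, hA, rfl⟩
    exact h A hA
  · rintro _ ⟨A, hA, rfl⟩
    exact h A hA

/-- An abelian subalgebra `P` and a functional `ξ` with `dim L + dim L(ξ) ≤ 2 dim P` determine
the magic number and the maximal abelian dimension. -/
theorem magicNumber_and_maxAbelianDim_eq [FiniteDimensional k L] (P : LieSubalgebra k L) (hP : IsLieAbelian P)
    (ξ : Module.Dual k L)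
    (h : Module.finrank k L + Module.finrank k (stabilizer k L ξ) ≤ 2 * Module.finrank k P) :
    magicNumber k L = Module.finrank k P ∧ maxAbelianDim k L = Module.finrank k P := by
  -- `P` is isotropic for every functional, so it bounds all stabilizers, hence the index, from
  -- below.
  have h1 : 2 * Module.finrank k P - Module.finrank k L ≤ index k L := le_index fun η => by
    have := two_mul_finrank_le_of_isotropic η P.toSubmodule (isotropic_of_abelian P η)
    change 2 * Module.finrank k P ≤ _ at this
    omega
  have h2 := index_le ξ
  refine ⟨by rw [magicNumber]; omega, maxAbelianDim_eq P hP fun A hA => ?_⟩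
  have := two_mul_finrank_le_of_isotropic ξ A.toSubmodule (isotropic_of_abelian A ξ)
  change 2 * Module.finrank k A ≤ _ at this
  omega

end Isotropic

/-! ### One-based coordinates and commuting spans -/

section Coordinates

variable {k : Type*} [Field k] {L : Type*} [LieRing L] [LieAlgebra k L]
variable {n : ℕ} (b : Module.Basis (Fin n) k L)

/-- The coordinate functions dual to `x₁, …, xₙ`, numbered from `1`. -/
def vcoord (i : ℕ) : Module.Dual k L :=
  if h : 1 ≤ i ∧ i ≤ n then b.coord ⟨i - 1, by omega⟩ else 0

theorem vec_eq {i : ℕ} (h1 : 1 ≤ i) (h2 : i ≤ n) : vec b i = b ⟨i - 1, by omega⟩ :=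
  dif_pos ⟨h1, h2⟩

theorem basis_eq_vec (i : Fin n) : b i = vec b (i + 1) := by
  rw [vec_eq b (by omega) (by omega)]
  simp

theorem vcoord_vec {i j : ℕ} (h1 : 1 ≤ j) (h2 : j ≤ n) :
    vcoord b i (vec b j) = if i = j then 1 else 0 := by
  unfold vcoord
  split_ifs with h h' h'
  · subst h'
    rw [vec_eq b h1 h2]; simp
  · rw [vec_eq b h1 h2, Module.Basis.coord_apply, Module.Basis.repr_self, Finsupp.single_apply, if_neg]
    rw [Fin.mk.injEq]; omega
  · omega
  · rfl

theorem sum_vcoord (x : L) : ∑ i ∈ Finset.Icc 1 n, vcoord b i x • vec b i = x := by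
  conv_rhs => rw [← b.sum_repr x]
  symm
  refine Finset.sum_bij (fun (i : Fin n) _ => (i : ℕ) + 1) (fun i _ => Finset.mem_Icc.mpr ⟨by omega, by omega⟩) ?_ ?_ ?_
  · intro i _ j _ h
    exact Fin.ext (by omega)
  · intro i hi
    rw [Finset.mem_Icc] at hi
    exact ⟨⟨i - 1, by omega⟩, Finset.mem_univ _, Nat.sub_add_cancel hi.1⟩
  · intro i _
    rw [← basis_eq_vec]
    unfold vcoord
    rw [dif_pos (by omega)]
    rfl

theorem eq_zero_of_vcoord {x : L} (h : ∀ i, 1 ≤ i → i ≤ n → vcoord b i x = 0) : x = 0 := by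
  rw [← sum_vcoord b x]
  refine Finset.sum_eq_zero fun i hi => ?_
  rw [Finset.mem_Icc] at hi
  rw [h i hi.1 hi.2, zero_smul]

theorem apply_lie_eq_sum (ξ : Module.Dual k L) (x y : L) :
    ξ ⁅x, y⁆ = ∑ i ∈ Finset.Icc 1 n, vcoord b i x * ξ ⁅vec b i, y⁆ := by
  conv_lhs => rw [← sum_vcoord b x]
  rw [sum_lie, map_sum]
  exact Finset.sum_congr rfl fun i _ => by rw [smul_lie, map_smul, smul_eq_mul]

/-- Only the term of index `m` survives when `ξ [x, y]` is expanded along the basis. With `y` the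
partner of `x_m`, this removes the coordinates of a stabilizer element one at a time. -/
theorem vcoord_eq_zero_of_apply_lie (ξ : Module.Dual k L) {x y : L} {m : ℕ} (h1 : 1 ≤ m)
    (h2 : m ≤ n) (hx : ξ ⁅x, y⁆ = 0)
    (h0 : ∀ i, 1 ≤ i → i ≤ n → i ≠ m → vcoord b i x = 0 ∨ ξ ⁅vec b i, y⁆ = 0)
    (hm : ξ ⁅vec b m, y⁆ ≠ 0) : vcoord b m x = 0 := by
  rw [apply_lie_eq_sum b, Finset.sum_eq_single m] at hx
  · exact (mul_eq_zero.mp hx).resolve_right hm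
  · intro i hi him
    rw [Finset.mem_Icc] at hi
    exact mul_eq_zero.mpr (h0 i hi.1 hi.2 him)
  · intro h
    exact absurd (Finset.mem_Icc.mpr ⟨h1, h2⟩) h

/-- The projection to the coordinates in `J` is injective on `W`. This bounds stabilizers without
computing them. -/
theorem finrank_le_card_of_vcoord (W : Submodule k L) (J : Finset ℕ)
    (h : ∀ x ∈ W, (∀ i ∈ J, vcoord b i x = 0) → x = 0) : Module.finrank k W ≤ J.card := by
  let F : W →ₗ[k] (J → k) := (LinearMap.pi fun i : J => vcoord b i).domRestrict W
  have hF : Function.Injective F := by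
    rw [injective_iff_map_eq_zero]
    intro x hx
    exact Subtype.ext (h x x.2 fun i hi => congrFun hx ⟨i, hi⟩)
  simpa using LinearMap.finrank_le_finrank_of_injective hF

theorem linearIndependent_vec (s : ℕ) (hs : 1 ≤ s) :
    LinearIndependent k fun i : Finset.Icc s n => vec b i := by
  have h : (fun i : Finset.Icc s n => vec b i) = b ∘ fun i : Finset.Icc s n =>
      (⟨i - 1, by have := Finset.mem_Icc.mp i.2; omega⟩ : Fin n) := by
    funext i
    have := Finset.mem_Icc.mp i.2
    exact vec_eq b (by omega) (by omega)
  rw [h]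
  refine b.linearIndependent.comp _ fun i j hij => ?_
  have hi := Finset.mem_Icc.mp i.2
  have hj := Finset.mem_Icc.mp j.2
  rw [Fin.mk.injEq] at hij
  exact Subtype.ext (by omega)

theorem finrank_span_vec (s : ℕ) (hs : 1 ≤ s) :
    Module.finrank k (Submodule.span k (vec b '' Set.Icc s n)) = n + 1 - s := by
  have h := finrank_span_eq_card (linearIndependent_vec b s hs)
  have hr : Set.range (fun i : Finset.Icc s n => vec b i) = vec b '' Set.Icc s n := by
    ext x
    simp
  rw [hr] at h
  simpa using h

theorem lie_eq_zero_of_mem_span {S : Set L} (h : ∀ x ∈ S, ∀ y ∈ S, ⁅x, y⁆ = 0) {x y : L}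
    (hx : x ∈ Submodule.span k S) (hy : y ∈ Submodule.span k S) : ⁅x, y⁆ = 0 := by
  induction hx using Submodule.span_induction with
  | mem x hx =>
    induction hy using Submodule.span_induction with
    | mem y hy => exact h x hx y hy
    | zero => simp
    | add y z _ _ hy hz => rw [lie_add, hy, hz, add_zero]
    | smul c y _ hy => rw [lie_smul, hy, smul_zero]
  | zero => simp
  | add y z _ _ hy hz => rw [add_lie, hy, hz, add_zero]
  | smul c y _ hy => rw [smul_lie, hy, smul_zero]

/-- The span of pairwise commuting elements, as a Lie subalgebra. -/
def commutingSpan (S : Set L) (h : ∀ x ∈ S, ∀ y ∈ S, ⁅x, y⁆ = 0) : LieSubalgebra k L :=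
  { Submodule.span k S with
    lie_mem' := fun hx hy => by
      rw [lie_eq_zero_of_mem_span h hx hy]
      exact Submodule.zero_mem _ }

theorem isLieAbelian_commutingSpan (S : Set L) (h : ∀ x ∈ S, ∀ y ∈ S, ⁅x, y⁆ = 0) :
    IsLieAbelian (commutingSpan (k := k) S h) :=
  ⟨fun x y => Subtype.ext (lie_eq_zero_of_mem_span h x.2 y.2)⟩

theorem lie_vec_eq_zero {s : ℕ}
    (h : ∀ i j, s ≤ i → i < j → j ≤ n → ⁅vec b i, vec b j⁆ = 0) :
    ∀ x ∈ vec b '' Set.Icc s n, ∀ y ∈ vec b '' Set.Icc s n, ⁅x, y⁆ = 0 := by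
  rintro _ ⟨i, hi, rfl⟩ _ ⟨j, hj, rfl⟩
  rcases lt_trichotomy i j with hij | rfl | hij
  · exact h i j hi.1 hij hj.2
  · exact lie_self _
  · rw [← lie_skew, h j i hj.1 hij hi.2, neg_zero]

/-- If `ξ [xᵢ, xⱼ]` vanishes for `i < j` outside a symmetric relation `c`, then it vanishes for all
`i` and `j` outside `c`. -/
theorem apply_lie_vec_eq_zero (ξ : Module.Dual k L) {c : ℕ → ℕ → Prop} (hc : ∀ i j, c i j → c j i)
    (h : ∀ i j, 1 ≤ i → i < j → j ≤ n → ¬ c i j → ξ ⁅vec b i, vec b j⁆ = 0) {i j : ℕ}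
    (hi : 1 ≤ i) (hin : i ≤ n) (hj : 1 ≤ j) (hjn : j ≤ n) (hij : ¬ c i j) :
    ξ ⁅vec b i, vec b j⁆ = 0 := by
  rcases lt_trichotomy i j with h' | rfl | h'
  · exact h i j hi h' hjn hij
  · rw [lie_self, map_zero]
  · rw [← lie_skew, map_neg, h j i hj h' hin fun h => hij (hc _ _ h), neg_zero]

end Coordinates

/-! ### The Poisson bracket as a biderivation; transcendence degree -/

section Poisson

variable {k : Type*} [Field k] {L : Type*} [LieRing L] [LieAlgebra k L]
variable {ι : Type*} (b : Module.Basis ι k L)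

open MvPolynomial

theorem toSym_basis (i : ι) : toSym b (b i) = X i := by
  rw [toSym, Module.Basis.constr_basis]

theorem toSym_mem_adjoin_of_mem_span {S : Set L} {x : L} (hx : x ∈ Submodule.span k S) :
    toSym b x ∈ Algebra.adjoin k (toSym b '' S) := by
  have h : toSym b x ∈ Submodule.span k (toSym b '' S) := by
    rw [← Submodule.map_span]
    exact Submodule.mem_map_of_mem hx
  exact Algebra.span_le_adjoin k _ h

theorem trdeg_adjoin_of_algebraicIndependent {κ : Type} [Fintype κ] {v : κ → MvPolynomial ι k}
    (hv : AlgebraicIndependent k v) :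
    Algebra.trdeg k (Algebra.adjoin k (Set.range v)) = (Fintype.card κ : Cardinal) := by
  have h := hv.aevalEquiv.lift_trdeg_eq
  rw [MvPolynomial.trdeg_of_isDomain] at h
  rw [← Cardinal.lift_inj, ← h]
  simp

theorem symSub_span (S : Set L) :
    symSub b (Submodule.span k S) = Algebra.adjoin k (toSym b '' S) := by
  refine le_antisymm (Algebra.adjoin_le ?_) (Algebra.adjoin_mono ?_)
  · rintro _ ⟨x, hx, rfl⟩
    exact toSym_mem_adjoin_of_mem_span b hx
  · exact Set.image_mono Submodule.subset_span

variable [Fintype ι]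

/-- The derivation `{f, ·}` of `S(L)`. -/
def hamiltonian (f : MvPolynomial ι k) : Derivation k (MvPolynomial ι k) (MvPolynomial ι k) :=
  ∑ i, ∑ j, (toSym b ⁅b i, b j⁆ * pderiv i f) • pderiv j

theorem hamiltonian_apply (f g : MvPolynomial ι k) : hamiltonian b f g = poissonBracket b f g := by
  have h := fun (s : Finset ι) (D : ι → Derivation k (MvPolynomial ι k) (MvPolynomial ι k)) =>
    map_sum ((Pi.evalAddMonoidHom _ g).comp Derivation.coeFnAddMonoidHom) D s
  exact (h _ _).trans (Finset.sum_congr rfl fun i _ => h _ _)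

theorem poissonBracket_skew (f g : MvPolynomial ι k) :
    poissonBracket b f g = -poissonBracket b g f := by
  unfold poissonBracket
  rw [Finset.sum_comm, ← Finset.sum_neg_distrib]
  refine Finset.sum_congr rfl fun i _ => ?_
  rw [← Finset.sum_neg_distrib]
  refine Finset.sum_congr rfl fun j _ => ?_
  rw [← lie_skew, map_neg]
  ring

theorem poissonBracket_X_X (i j : ι) :
    poissonBracket b (X i) (X j) = toSym b ⁅b i, b j⁆ := by
  classical
  unfold poissonBracket
  rw [Finset.sum_eq_single i, Finset.sum_eq_single j]
  · simp
  · intro l _ hl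
    rw [pderiv_X_of_ne hl.symm, mul_zero]
  · simp
  · intro l _ hl
    refine Finset.sum_eq_zero fun m _ => ?_
    rw [pderiv_X_of_ne hl.symm, mul_zero, zero_mul]
  · simp

theorem mem_poissonCenter_of_X {f : MvPolynomial ι k}
    (h : ∀ i, poissonBracket b (X i) f = 0) : f ∈ poissonCenter b := by
  intro g
  rw [← hamiltonian_apply]
  have h0 : hamiltonian b f = 0 := derivation_ext fun i => by
    rw [hamiltonian_apply, poissonBracket_skew, h i, neg_zero]; rfl
  rw [h0]; rfl

/-- The derivation `{f, ·}` vanishes on an algebra once it vanishes on generators; skew-symmetry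
then transfers this to the other argument. -/
theorem isPoissonCommutative_adjoin {G : Set (MvPolynomial ι k)}
    (h : ∀ f ∈ G, ∀ g ∈ G, poissonBracket b f g = 0) :
    IsPoissonCommutative b (Algebra.adjoin k G) := by
  have key : ∀ f, (∀ g ∈ G, poissonBracket b f g = 0) →
      ∀ g ∈ Algebra.adjoin k G, poissonBracket b f g = 0 := by
    intro f hf g hg
    have h1 : Set.EqOn (hamiltonian b f) (0 : Derivation k (MvPolynomial ι k) _) G := fun g hg => by
      rw [hamiltonian_apply, hf g hg]; rfl
    rw [← hamiltonian_apply, Derivation.eqOn_adjoin h1 hg]; rfl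
  intro f hf g hg
  refine key f (fun g' hg' => ?_) g hg
  rw [poissonBracket_skew, key g' (fun f' hf' => h g' hg' f' hf') f hf, neg_zero]

end Poisson

/-! ### Linear forms and commutative polarizations spanned by basis tails -/

section Var

open MvPolynomial

variable {k : Type*} [Field k] {L : Type*} [LieRing L] [LieAlgebra k L]
variable {n : ℕ} (b : Module.Basis (Fin n) k L)

theorem var_eq {i : ℕ} (h1 : 1 ≤ i) (h2 : i ≤ n) : var b i = X ⟨i - 1, by omega⟩ := by
  rw [var, vec_eq b h1 h2, toSym_basis]

theorem X_eq_var (i : Fin n) : X i = var b (i + 1) := by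
  rw [var, ← basis_eq_vec, toSym_basis]

theorem poissonBracket_var {i j : ℕ} (hi : 1 ≤ i) (hin : i ≤ n) (hj : 1 ≤ j) (hjn : j ≤ n) :
    poissonBracket b (var b i) (var b j) = toSym b ⁅vec b i, vec b j⁆ := by
  rw [var_eq b hi hin, var_eq b hj hjn, poissonBracket_X_X, vec_eq b hi hin, vec_eq b hj hjn]

theorem var_isHomogeneous {i : ℕ} (h1 : 1 ≤ i) (h2 : i ≤ n) : (var b i).IsHomogeneous 1 := by
  rw [var_eq b h1 h2]
  exact isHomogeneous_X k _

theorem symSub_span_vec (s : ℕ) :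
    symSub b (Submodule.span k (vec b '' Set.Icc s n)) =
      Algebra.adjoin k (var b '' Set.Icc s n) := by
  rw [symSub_span, Set.image_image]
  rfl

theorem poissonBracket_var_eq_zero {s : ℕ} (hs : 1 ≤ s)
    (h : ∀ i j, s ≤ i → i < j → j ≤ n → ⁅vec b i, vec b j⁆ = 0) :
    ∀ f ∈ var b '' Set.Icc s n, ∀ g ∈ var b '' Set.Icc s n, poissonBracket b f g = 0 := by
  rintro _ ⟨i, hi, rfl⟩ _ ⟨j, hj, rfl⟩
  rw [poissonBracket_var b (hs.trans hi.1) hi.2 (hs.trans hj.1) hj.2,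
    lie_vec_eq_zero b h _ ⟨i, hi, rfl⟩ _ ⟨j, hj, rfl⟩, map_zero]

theorem algebraicIndependent_var {J : Finset ℕ} (hJ : J ⊆ Finset.Icc 1 n) :
    AlgebraicIndependent k fun i : J => var b i := by
  have hJ' : ∀ i : J, 1 ≤ (i : ℕ) ∧ (i : ℕ) ≤ n := fun i => Finset.mem_Icc.mp (hJ i.2)
  have h : (fun i : J => var b i) = X ∘ fun i : J =>
      (⟨i - 1, by have := hJ' i; omega⟩ : Fin n) :=
    funext fun i => var_eq b (hJ' i).1 (hJ' i).2
  rw [h]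
  refine (MvPolynomial.algebraicIndependent_X (Fin n) k).comp _ fun i j hij => ?_
  have hi := hJ' i
  have hj := hJ' j
  rw [Fin.mk.injEq] at hij
  exact Subtype.ext (by omega)

/-- If `x_s, …, xₙ` commute and a stabilizer is small enough, then `⟨x_s, …, xₙ⟩` is a commutative
polarization, and its symmetric algebra is a complete Poisson commutative subalgebra. -/
theorem commutativePolarization_of_span {s : ℕ} (hs : 1 ≤ s)
    (h : ∀ i j, s ≤ i → i < j → j ≤ n → ⁅vec b i, vec b j⁆ = 0) (ξ : Module.Dual k L)
    (hξ : n + Module.finrank k (stabilizer k L ξ) ≤ 2 * (n + 1 - s)) :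
    RProperty k L ∧ HasCommutativePolarization k L ∧ maxAbelianDim k L = n + 1 - s ∧
      MilovanovHolds b := by
  have : FiniteDimensional k L := b.finiteDimensional_of_finite
  have hL : Module.finrank k L = n := by rw [Module.finrank_eq_card_basis b, Fintype.card_fin]
  have hcomm := lie_vec_eq_zero b h
  have hP := isLieAbelian_commutingSpan (k := k) _ hcomm
  have hd : Module.finrank k (commutingSpan (k := k) _ hcomm) = n + 1 - s := finrank_span_vec b s hs
  obtain ⟨hc, hα⟩ := magicNumber_and_maxAbelianDim_eq _ hP ξ (by rw [hL, hd]; exact hξ)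
  have hCP : HasCommutativePolarization k L := ⟨_, hP, hc.symm⟩
  refine ⟨Or.inl hCP, hCP, hα.trans hd, Algebra.adjoin k (var b '' Set.Icc s n),
    ⟨isPoissonCommutative_adjoin b (poissonBracket_var_eq_zero b hs h), ?_⟩, _, ?_, rfl⟩
  · have ht := trdeg_adjoin_of_algebraicIndependent (algebraicIndependent_var b
      (Finset.Icc_subset_Icc_left (b := n) hs))
    have hr : Set.range (fun i : Finset.Icc s n => var b i) = var b '' Set.Icc s n := by
      ext x
      simp
    rw [hr] at ht
    rw [ht, hc, hd]
    simp
  · rintro _ ⟨i, hi, rfl⟩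
    exact (var_isHomogeneous b (hs.trans hi.1) hi.2).totalDegree_le.trans one_le_two

end Var

/-! ### Types `L`, `R` and `W` -/

section Types

variable {k : Type*} [Field k] {L : Type*} [LieRing L] [LieAlgebra k L]
variable {n : ℕ} (b : Module.Basis (Fin n) k L)

/-- The form of `xₙ*` pairs only `x₁` with `xₙ₋₁`, so it has rank 2, and `n + (n - 2) = 2 (n - 1)`
matches the tail from `x₂`. -/
theorem typeL_conclusion (hn : 3 ≤ n) (h : IsTypeL b) :
    RProperty k L ∧ HasCommutativePolarization k L ∧ maxAbelianDim k L = n - 1 ∧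
      MilovanovHolds b := by
  have h0 : ∀ {i j}, 1 ≤ i → i ≤ n → 1 ≤ j → j ≤ n →
      ¬ (i = 1 ∧ j = n - 1 ∨ i = n - 1 ∧ j = 1) → vcoord b n ⁅vec b i, vec b j⁆ = 0 := by
    refine apply_lie_vec_eq_zero b (vcoord b n)
      (c := fun i j => i = 1 ∧ j = n - 1 ∨ i = n - 1 ∧ j = 1) (by omega) fun i j hi hij hj hc => ?_
    rw [h i j hi hij hj]
    split_ifs
    · rw [vcoord_vec b (by omega) (by omega), if_neg (by omega)]
    · rw [map_zero]
  have h1 : vcoord b n ⁅vec b 1, vec b (n - 1)⁆ = 1 := by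
    rw [h 1 (n - 1) (by omega) (by omega) (by omega), if_pos ⟨rfl, le_rfl⟩,
      vcoord_vec b (by omega) (by omega), if_pos (by omega)]
  have hst : Module.finrank k (stabilizer k L (vcoord b n)) ≤ n - 2 := by
    refine (finrank_le_card_of_vcoord b _ ((Finset.Icc 1 n).filter fun i => i ≠ 1 ∧ i ≠ n - 1)
      fun x hx hJ => eq_zero_of_vcoord b fun i hi hin => ?_).trans ?_
    · by_cases hi1 : i = 1
      · subst hi1
        refine vcoord_eq_zero_of_apply_lie b _ le_rfl (by omega) (hx (vec b (n - 1)))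
          (fun i hi hin hi1 => Or.inr (h0 hi hin (by omega) (by omega) (by omega))) ?_
        rw [h1]; exact one_ne_zero
      · by_cases hi2 : i = n - 1
        · subst hi2
          refine vcoord_eq_zero_of_apply_lie b _ (by omega) (by omega) (hx (vec b 1))
            (fun i hi hin hi1 => Or.inr (h0 hi hin (by omega) (by omega) (by omega))) ?_
          rw [← lie_skew, map_neg, h1]; simp
        · exact hJ i (by simp; omega)
    · have : (Finset.Icc 1 n).filter (fun i => i ≠ 1 ∧ i ≠ n - 1) = Finset.Icc 1 n \ {1, n - 1} := by
        ext i; simp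
      rw [this, Finset.card_sdiff_of_subset (by intro i; simp; omega), Finset.card_pair (by omega)]
      simp
  exact commutativePolarization_of_span b (s := 2) (by omega) (fun i j hi hij hj => by
    rw [h i j (by omega) hij hj, if_neg (by omega)]) (vcoord b n) (by omega)

/-- The form of `xₙ*` pairs `x₁` with `xₙ₋₁` and `x₂` with `xₙ₋₂`, so it has rank 4, and `n + (n -
4) = 2 (n - 2)` matches the tail from `x₃`. -/
theorem typeR_conclusion (hn : 5 ≤ n) (h : IsTypeR b) :
    RProperty k L ∧ HasCommutativePolarization k L ∧ maxAbelianDim k L = n - 2 ∧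
      MilovanovHolds b := by
  have h0 : ∀ {i j}, 1 ≤ i → i ≤ n → 1 ≤ j → j ≤ n →
      ¬ (i + j = n ∧ (i ≤ 2 ∨ j ≤ 2)) → vcoord b n ⁅vec b i, vec b j⁆ = 0 := by
    refine apply_lie_vec_eq_zero b (vcoord b n)
      (c := fun i j => i + j = n ∧ (i ≤ 2 ∨ j ≤ 2)) (by omega) fun i j hi hij hj hc => ?_
    rw [h i j hi hij hj]
    split_ifs
    · rw [vcoord_vec b (by omega) (by omega), if_neg (by omega)]
    · rw [vcoord_vec b (by omega) (by omega), if_neg (by omega)]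
    · rw [map_zero]
  have h1 : ∀ i, 1 ≤ i → i ≤ 2 → vcoord b n ⁅vec b i, vec b (n - i)⁆ = 1 := by
    intro i hi hi2
    rw [h i (n - i) (by omega) (by omega) (by omega)]
    split_ifs
    · rw [vcoord_vec b (by omega) (by omega), if_pos (by omega)]
    · rw [vcoord_vec b (by omega) (by omega), if_pos (by omega)]
    · omega
  have hst : Module.finrank k (stabilizer k L (vcoord b n)) ≤ n - 4 := by
    refine (finrank_le_card_of_vcoord b _ (insert n (Finset.Icc 3 (n - 3)))
      fun x hx hJ => eq_zero_of_vcoord b fun i hi hin => ?_).trans ?_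
    · by_cases hi1 : i ≤ 2
      · refine vcoord_eq_zero_of_apply_lie b _ hi (by omega) (hx (vec b (n - i)))
          (fun i hi hin hi1 => Or.inr (h0 hi hin (by omega) (by omega) (by omega))) ?_
        rw [h1 i hi hi1]; exact one_ne_zero
      · by_cases hi2 : i = n - 1 ∨ i = n - 2
        · refine vcoord_eq_zero_of_apply_lie b _ (by omega) (by omega) (hx (vec b (n - i)))
            (fun i hi hin hi1 => Or.inr (h0 hi hin (by omega) (by omega) (by omega))) ?_
          have := h1 (n - i) (by omega) (by omega)
          rw [Nat.sub_sub_self hin] at this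
          rw [← lie_skew, map_neg, this]; simp
        · exact hJ i (by simp; omega)
    · refine (Finset.card_insert_le _ _).trans ?_
      simp
      omega
  exact commutativePolarization_of_span b (s := 3) (by omega) (fun i j hi hij hj => by
    rw [h i j (by omega) hij hj, if_neg (by omega), if_neg (by omega)]) (vcoord b n) (by omega)

/-- The form of `xₙ*` pairs `xᵢ` with `xₙ₋ᵢ`; for `i ≥ 2` the coefficient is a nonzero multiple of
`n - 2i`. Beyond index `s = ⌊(n + 1) / 2⌋` weights of distinct vectors add up to more than `n`, so
the tail from `x_s` is abelian. -/
theorem typeW_conclusion [CharZero k] (hn : 3 ≤ n) (h : IsTypeW b) :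
    RProperty k L ∧ HasCommutativePolarization k L ∧ maxAbelianDim k L = (n + 2) / 2 ∧
      MilovanovHolds b := by
  have h0 : ∀ {i j}, 1 ≤ i → i ≤ n → 1 ≤ j → j ≤ n →
      ¬ (i + j = n) → vcoord b n ⁅vec b i, vec b j⁆ = 0 := by
    refine apply_lie_vec_eq_zero b (vcoord b n)
      (c := fun i j => i + j = n) (by omega) fun i j hi hij hj hc => ?_
    rw [h i j hi hij hj]
    split_ifs
    · rw [vcoord_vec b (by omega) (by omega), if_neg (by omega)]
    · rw [map_smul, vcoord_vec b (by omega) (by omega), if_neg (by omega), smul_zero]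
    · rw [map_zero]
  have h1 : ∀ i, 1 ≤ i → 2 * i < n → vcoord b n ⁅vec b i, vec b (n - i)⁆ ≠ 0 := by
    intro i hi hi2
    rw [h i (n - i) (by omega) (by omega) (by omega)]
    split_ifs
    · rw [vcoord_vec b (by omega) (by omega), if_pos (by omega)]
      exact one_ne_zero
    · rw [map_smul, vcoord_vec b (by omega) (by omega), if_pos (by omega), smul_eq_mul, mul_one]
      have hne : ((n - i : ℕ) : k) - (i : k) ≠ 0 := by
        rw [sub_ne_zero, Ne, Nat.cast_inj]
        omega
      have hf : ∀ m : ℕ, (m ! : k) ≠ 0 := fun m => Nat.cast_ne_zero.mpr (Nat.factorial_ne_zero m)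
      exact div_ne_zero (mul_ne_zero (mul_ne_zero (mul_ne_zero (by norm_num) (hf _)) (hf _)) hne)
        (hf _)
    · omega
  -- The bound is 1 for odd `n` and 2 for even `n`: besides `xₙ`, only the self-paired `x_{n/2}` can
  -- survive, and the interval below is empty when `n` is odd.
  have hst : Module.finrank k (stabilizer k L (vcoord b n)) ≤
      2 * (n + 1 - (n + 1) / 2) - n := by
    refine (finrank_le_card_of_vcoord b _ (insert n (Finset.Ico ((n + 1) / 2) (n / 2 + 1)))
      fun x hx hJ => eq_zero_of_vcoord b fun i hi hin => ?_).trans ?_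
    · rcases lt_trichotomy (2 * i) n with hi1 | hi1 | hi1
      · exact vcoord_eq_zero_of_apply_lie b _ hi (by omega) (hx (vec b (n - i)))
          (fun i hi hin hi1 => Or.inr (h0 hi hin (by omega) (by omega) (by omega))) (h1 i hi hi1)
      · exact hJ i (by simp; omega)
      · by_cases hi2 : i = n
        · exact hJ i (by simp; omega)
        · refine vcoord_eq_zero_of_apply_lie b _ (by omega) (by omega) (hx (vec b (n - i)))
            (fun i hi hin hi1 => Or.inr (h0 hi hin (by omega) (by omega) (by omega))) ?_
          have := h1 (n - i) (by omega) (by omega)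
          rw [Nat.sub_sub_self hin] at this
          rw [← lie_skew, map_neg]
          exact neg_ne_zero.mpr this
    · refine (Finset.card_insert_le _ _).trans ?_
      simp
      omega
  have hα : n + 1 - (n + 1) / 2 = (n + 2) / 2 := by omega
  rw [← hα]
  exact commutativePolarization_of_span b (by omega) (fun i j hi hij hj => by
    rw [h i j (by omega) hij hj, if_neg (by omega), if_neg (by omega)]) (vcoord b n) (by omega)

end Types

/-! ### Type `Q`: brackets, index and abelian subalgebras -/

section TypeQ

variable {k : Type*} [Field k] {L : Type*} [LieRing L] [LieAlgebra k L]
variable {n : ℕ} {b : Module.Basis (Fin n) k L}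

namespace IsTypeQ

theorem lie_one (h : IsTypeQ b) {j : ℕ} (hj : 2 ≤ j) (hjn : j + 2 ≤ n) :
    ⁅vec b 1, vec b j⁆ = vec b (j + 1) := by
  rw [h 1 j le_rfl (by omega) (by omega), if_pos ⟨rfl, by omega⟩]

theorem lie_one_eq_zero (h : IsTypeQ b) {j : ℕ} (hj : n ≤ j + 1) (hj2 : 2 ≤ j) (hjn : j ≤ n) :
    ⁅vec b 1, vec b j⁆ = 0 := by
  rw [h 1 j le_rfl (by omega) (by omega), if_neg (by omega), if_neg (by omega)]

theorem lie_eq_zero (h : IsTypeQ b) {i j : ℕ} (hi : 2 ≤ i) (hin : i ≤ n) (hj : 2 ≤ j) (hjn : j ≤ n)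
    (hij : i + j ≠ n + 1) : ⁅vec b i, vec b j⁆ = 0 := by
  rcases lt_trichotomy i j with h' | rfl | h'
  · rw [h i j (by omega) h' hjn, if_neg (by omega), if_neg (by omega)]
  · exact lie_self _
  · rw [← lie_skew, h j i (by omega) h' hin, if_neg (by omega), if_neg (by omega), neg_zero]

/-- As `n` is even, `i` and `j` have opposite parity, so the sign rule is compatible with
skew-symmetry and holds in either order. -/
theorem lie_eq (h : IsTypeQ b) (hn : Even n) {i j : ℕ} (hi : 2 ≤ i) (hj : 2 ≤ j)
    (hij : i + j = n + 1) : ⁅vec b i, vec b j⁆ = ((-1 : k) ^ (i + 1)) • vec b n := by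
  obtain ⟨r, hr⟩ := hn
  rcases lt_trichotomy i j with h' | h' | h'
  · rw [h i j (by omega) h' (by omega), if_neg (by omega), if_pos ⟨hi, hij⟩]
  · omega
  · rw [← lie_skew, h j i (by omega) h' (by omega), if_neg (by omega), if_pos ⟨hj, by omega⟩,
      ← neg_smul]
    congr 1
    rcases Nat.even_or_odd i with hi' | hi'
    · have hj' : Odd j := by grind
      rw [hj'.add_one.neg_one_pow, hi'.add_one.neg_one_pow]
    · have hj' : Even j := by grind
      rw [hj'.add_one.neg_one_pow, hi'.add_one.neg_one_pow, neg_neg]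

theorem lie_last (h : IsTypeQ b) (hn : 4 ≤ n) (y : L) : ⁅vec b n, y⁆ = 0 := by
  rw [← sum_vcoord b y, lie_sum]
  refine Finset.sum_eq_zero fun j hj => ?_
  rw [Finset.mem_Icc] at hj
  rw [lie_smul]
  by_cases hj1 : j = 1
  · subst hj1
    rw [← lie_skew, h.lie_one_eq_zero (by omega) (by omega) le_rfl, neg_zero, smul_zero]
  · rw [h.lie_eq_zero (by omega) le_rfl (by omega) hj.2 (by omega), smul_zero]

theorem lie_upper (h : IsTypeQ b) {q : ℕ} (hnq : n = 2 * q) (i j : ℕ) (hi : q + 1 ≤ i)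
    (hij : i < j) (hjn : j ≤ n) : ⁅vec b i, vec b j⁆ = 0 := by
  by_cases hq : 1 ≤ q
  · exact h.lie_eq_zero (by omega) (by omega) (by omega) hjn (by omega)
  · omega

theorem vcoord_last_lie (h : IsTypeQ b) {i j : ℕ} (hi : 1 ≤ i) (hin : i ≤ n) (hj : 2 ≤ j)
    (hjn : j < n) (hij : i + j ≠ n + 1) : vcoord b n ⁅vec b i, vec b j⁆ = 0 := by
  by_cases hi1 : i = 1
  · subst hi1
    by_cases hj' : j + 2 ≤ n
    · rw [h.lie_one hj hj', vcoord_vec b (by omega) (by omega), if_neg (by omega)]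
    · rw [h.lie_one_eq_zero (by omega) hj hjn.le, map_zero]
  · rw [h.lie_eq_zero (by omega) hin hj hjn.le hij, map_zero]

theorem finrank_stabilizer_le (h : IsTypeQ b) (hn : Even n) :
    Module.finrank k (stabilizer k L (vcoord b n)) ≤ 2 := by
  refine (finrank_le_card_of_vcoord b _ {1, n}
    fun x hx hJ => eq_zero_of_vcoord b fun i hi hin => ?_).trans Finset.card_le_two
  by_cases hi1 : i = 1 ∨ i = n
  · exact hJ i (by simpa using hi1)
  · refine vcoord_eq_zero_of_apply_lie b _ hi hin (hx (vec b (n + 1 - i)))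
      (fun i' hi' hin' hii' => Or.inr
        (h.vcoord_last_lie hi' hin' (by omega) (by omega) (by omega))) ?_
    rw [h.lie_eq hn (by omega) (by omega) (by omega), map_smul, vcoord_vec b (by omega) le_rfl,
      if_pos rfl, smul_eq_mul, mul_one]
    exact pow_ne_zero _ (neg_ne_zero.mpr one_ne_zero)

/-- A skew matrix of odd size `n - 1` is singular, so the form has a radical vector on `⟨x₁, …,
xₙ₋₁⟩`. It stays in the stabilizer because `xₙ` is central, and `xₙ` is a second, independent
vector. -/
theorem two_le_finrank_stabilizer [CharZero k] (h : IsTypeQ b) (hn : Even n) (hn4 : 4 ≤ n)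
    (ξ : Module.Dual k L) : 2 ≤ Module.finrank k (stabilizer k L ξ) := by
  have : FiniteDimensional k L := b.finiteDimensional_of_finite
  let M : Matrix (Fin (n - 1)) (Fin (n - 1)) k :=
    Matrix.of fun i j => ξ ⁅vec b (i + 1), vec b (j + 1)⁆
  have hM : M.transpose = -M := by
    ext i j
    change ξ ⁅_, _⁆ = -ξ ⁅_, _⁆
    rw [← lie_skew, map_neg]
  have hdet : M.det = 0 := by
    have h1 := M.det_transpose
    have h2 : Odd (n - 1) := by grind
    rw [hM, Matrix.det_neg, Fintype.card_fin, h2.neg_one_pow, neg_one_mul] at h1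
    exact self_eq_neg.mp h1.symm
  obtain ⟨w, hw, hwM⟩ := Matrix.exists_vecMul_eq_zero_iff.mpr hdet
  set x : L := ∑ i : Fin (n - 1), w i • vec b (i + 1) with hx
  have hxc : ∀ i : Fin (n - 1), vcoord b (i + 1) x = w i := by
    intro i
    rw [hx, map_sum, Finset.sum_eq_single i]
    · rw [map_smul, vcoord_vec b (by omega) (by omega), if_pos rfl, smul_eq_mul, mul_one]
    · intro j _ hj
      rw [map_smul, vcoord_vec b (by omega) (by omega), if_neg, smul_zero]
      intro hij
      exact hj (Fin.ext (by omega))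
    · simp
  have hxs : x ∈ stabilizer k L ξ := by
    intro y
    rw [← lie_skew, map_neg, apply_lie_eq_sum b, neg_eq_zero]
    refine Finset.sum_eq_zero fun j hj => ?_
    rw [Finset.mem_Icc] at hj
    by_cases hjn : j = n
    · rw [hjn, h.lie_last hn4, map_zero, mul_zero]
    · have h1 := congrFun hwM ⟨j - 1, by omega⟩
      simp only [Matrix.vecMul, dotProduct, M, Matrix.of_apply, Nat.sub_add_cancel hj.1,
        Pi.zero_apply] at h1
      rw [← lie_skew, map_neg, hx, sum_lie, map_sum]
      simp only [smul_lie, map_smul, smul_eq_mul]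
      rw [h1, neg_zero, mul_zero]
  have hns : vec b n ∈ stabilizer k L ξ := fun y => by rw [h.lie_last hn4, map_zero]
  have hli : LinearIndependent k ![(⟨x, hxs⟩ : stabilizer k L ξ), ⟨vec b n, hns⟩] := by
    rw [LinearIndependent.pair_iff]
    intro s t hst
    have hst' : s • x + t • vec b n = 0 := congrArg Subtype.val hst
    have hs : s = 0 := by
      by_contra hs
      refine hw (funext fun i => ?_)
      have h1 := congrArg (vcoord b (i + 1)) hst'
      rw [map_add, map_smul, map_smul, hxc, vcoord_vec b (by omega) le_rfl, if_neg (by omega),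
        smul_zero, add_zero, map_zero] at h1
      exact (mul_eq_zero.mp h1).resolve_left hs
    refine ⟨hs, ?_⟩
    have h1 := congrArg (vcoord b n) hst'
    rw [hs, zero_smul, zero_add, map_smul, vcoord_vec b (by omega) le_rfl, if_pos rfl, map_zero,
      smul_eq_mul, mul_one] at h1
    exact h1
  simpa using hli.fintype_card_le_finrank

theorem magicNumber_eq [CharZero k] (h : IsTypeQ b) {q : ℕ} (hq : 3 ≤ q) (hnq : n = 2 * q) :
    magicNumber k L = q + 1 := by
  have hL : Module.finrank k L = n := by rw [Module.finrank_eq_card_basis b, Fintype.card_fin]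
  have hn : Even n := ⟨q, by omega⟩
  have h1 := index_le (vcoord b n)
  have h2 := h.finrank_stabilizer_le hn
  have h3 := le_index fun ξ => h.two_le_finrank_stabilizer hn (by omega) ξ
  rw [magicNumber]
  omega

/-- Isotropy for `xₙ*` alone only gives `q + 1`. If `A` has no `x₁`-component, adjoining the radical
vector `x₁` keeps it isotropic, which saves one dimension. Otherwise some `a ∈ A` acts almost like
`x₁`, and `dim A ≤ 3 ≤ q`. -/
theorem finrank_le_of_abelian (h : IsTypeQ b) {q : ℕ} (hq : 3 ≤ q) (hnq : n = 2 * q)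
    (A : LieSubalgebra k L) (hA : IsLieAbelian A) : Module.finrank k A ≤ q := by
  have : FiniteDimensional k L := b.finiteDimensional_of_finite
  have hn : Even n := ⟨q, by omega⟩
  have hL : Module.finrank k L = n := by rw [Module.finrank_eq_card_basis b, Fintype.card_fin]
  by_cases hA1 : ∀ x ∈ A, vcoord b 1 x = 0
  · have h1 : ∀ y, vcoord b n ⁅vec b 1, y⁆ = 0 := by
      intro y
      rw [← lie_skew, map_neg, apply_lie_eq_sum b, neg_eq_zero]
      refine Finset.sum_eq_zero fun j hj => ?_
      rw [Finset.mem_Icc] at hj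
      rw [← lie_skew, map_neg]
      by_cases hj1 : j = 1
      · rw [hj1, lie_self, map_zero, neg_zero, mul_zero]
      by_cases hj2 : j = n
      · rw [hj2, h.lie_one_eq_zero (by omega) (by omega) le_rfl, map_zero, neg_zero, mul_zero]
      · rw [h.vcoord_last_lie le_rfl (by omega) (by omega) (by omega) (by omega), neg_zero,
          mul_zero]
    have hiso := two_mul_finrank_le_of_isotropic (vcoord b n)
      (A.toSubmodule ⊔ Submodule.span k {vec b 1}) (by
        intro x hx y hy
        obtain ⟨a, ha, u, hu, rfl⟩ := Submodule.mem_sup.mp hx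
        obtain ⟨a', ha', u', hu', rfl⟩ := Submodule.mem_sup.mp hy
        obtain ⟨c, rfl⟩ := Submodule.mem_span_singleton.mp hu
        obtain ⟨c', rfl⟩ := Submodule.mem_span_singleton.mp hu'
        have h2 := isotropic_of_abelian A (vcoord b n) a ha a' ha'
        have h3 : vcoord b n ⁅a, vec b 1⁆ = 0 := by rw [← lie_skew, map_neg, h1, neg_zero]
        simp [h1, h2, h3])
    have hinf : A.toSubmodule ⊓ Submodule.span k {vec b 1} = ⊥ := by
      rw [eq_bot_iff]
      rintro x ⟨hx, hx'⟩
      obtain ⟨c, rfl⟩ := Submodule.mem_span_singleton.mp hx'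
      have h2 := hA1 _ hx
      rw [map_smul, vcoord_vec b le_rfl (by omega), if_pos rfl, smul_eq_mul, mul_one] at h2
      rw [h2, zero_smul]
      exact Submodule.zero_mem _
    have hsup := Submodule.finrank_sup_add_finrank_inf_eq A.toSubmodule
      (Submodule.span k {vec b 1})
    have hv : vec b 1 ≠ 0 := by
      rw [vec_eq b le_rfl (by omega)]
      exact b.ne_zero _
    rw [hinf, finrank_bot, finrank_span_singleton hv] at hsup
    have hst := h.finrank_stabilizer_le hn
    change _ = Module.finrank k A + 1 at hsup
    omega
  · push Not at hA1
    obtain ⟨a, ha, ha1⟩ := hA1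
    -- For `x ∈ A` without `x₁`-component, `[a, x] = 0` kills the coordinates of index 2 to `n - 2`;
    -- these three are the rest.
    refine le_trans (finrank_le_card_of_vcoord b A.toSubmodule {1, n - 1, n} fun x hx hJ => ?_)
      (Finset.card_le_three.trans hq)
    have hx1 : vcoord b 1 x = 0 := hJ 1 (by simp)
    refine eq_zero_of_vcoord b fun i hi hin => ?_
    by_cases hi' : i = 1 ∨ i = n - 1 ∨ i = n
    · exact hJ i (by simpa using hi')
    -- Both arguments avoid `x₁`, so the bracket is a multiple of `xₙ`, while `i + 1 < n`.
    have hlast : ∀ j, 2 ≤ j → j ≤ n → vcoord b (i + 1) ⁅vec b j, x⁆ = 0 := by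
      intro j hj hjn
      rw [← lie_skew, map_neg, apply_lie_eq_sum b, neg_eq_zero]
      refine Finset.sum_eq_zero fun l hl => ?_
      rw [Finset.mem_Icc] at hl
      by_cases hl1 : l = 1
      · rw [hl1, hx1, zero_mul]
      by_cases hlj : l + j = n + 1
      · rw [h.lie_eq hn (by omega) hj hlj, map_smul, vcoord_vec b (by omega) le_rfl,
          if_neg (by omega), smul_zero, mul_zero]
      · rw [h.lie_eq_zero (by omega) hl.2 hj hjn hlj, map_zero, mul_zero]
    have hone : vcoord b (i + 1) ⁅vec b 1, x⁆ = 0 := by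
      have h2 := isotropic_of_abelian A (vcoord b (i + 1)) a ha x hx
      rw [apply_lie_eq_sum b, Finset.sum_eq_single 1] at h2
      · exact (mul_eq_zero.mp h2).resolve_left ha1
      · intro j hj hj1
        rw [Finset.mem_Icc] at hj
        rw [hlast j (by omega) hj.2, mul_zero]
      · intro h3
        exact absurd (Finset.mem_Icc.mpr ⟨le_rfl, by omega⟩) h3
    refine vcoord_eq_zero_of_apply_lie b (vcoord b (i + 1)) (y := vec b 1) hi hin
      (by rw [← lie_skew, map_neg, hone, neg_zero]) (fun l hl hln hli => Or.inr ?_) ?_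
    · rw [← lie_skew, map_neg, neg_eq_zero]
      by_cases hl1 : l = 1
      · rw [hl1, lie_self, map_zero]
      by_cases hl2 : l + 2 ≤ n
      · rw [h.lie_one (by omega) hl2, vcoord_vec b (by omega) (by omega), if_neg (by omega)]
      · rw [h.lie_one_eq_zero (by omega) (by omega) hln, map_zero]
    · rw [← lie_skew, map_neg, h.lie_one (by omega) (by omega), vcoord_vec b (by omega) (by omega),
        if_pos rfl]
      exact neg_ne_zero.mpr one_ne_zero

end IsTypeQ
end TypeQ

/-! ### The quadratic polynomial `f` and its derivatives -/

section QuadQ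

open MvPolynomial

variable {k : Type*} [Field k] {L : Type*} [LieRing L] [LieAlgebra k L]
variable {n : ℕ} (b : Module.Basis (Fin n) k L)

theorem sum_Icc_three_reflect {M : Type*} [AddCommMonoid M] (n : ℕ) (F : ℕ → M) :
    ∑ i ∈ Finset.Icc 3 (n - 1), F (n + 2 - i) = ∑ i ∈ Finset.Icc 3 (n - 1), F i := by
  refine Finset.sum_nbij' (fun i => n + 2 - i) (fun i => n + 2 - i) ?_ ?_ ?_ ?_ ?_ <;> intro i hi <;>
    rw [Finset.mem_Icc] at hi
  · exact Finset.mem_Icc.mpr (by omega)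
  · exact Finset.mem_Icc.mpr (by omega)
  · omega
  · omega

theorem neg_one_pow_reflect {n i : ℕ} (hn : Even n) (hi : i ≤ n + 2) :
    (-1 : k) ^ (n + 2 - i) = (-1) ^ i := by
  rcases Nat.even_or_odd i with h | h
  · have : Even (n + 2 - i) := by grind
    rw [h.neg_one_pow, this.neg_one_pow]
  · have : Odd (n + 2 - i) := by grind
    rw [h.neg_one_pow, this.neg_one_pow]

/-- The part of `quadQ` that does not involve `x₁`. -/
def quadTail : MvPolynomial (Fin n) k :=
  ∑ i ∈ Finset.Icc 3 (n - 1), ((-1 : k) ^ i) • (var b i * var b (n + 2 - i))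

/-- The reflection `i ↦ n + 2 - i` preserves signs, fixes `q + 1` and exchanges the two halves of
the symmetric range. Summing over the whole range absorbs both the factor 2 and the middle square.
-/
theorem quadQ_eq {q : ℕ} (hq : 3 ≤ q) (hnq : n = 2 * q) :
    quadQ b q = (2 : k) • (var b 1 * var b n) + quadTail b := by
  have hn : Even n := ⟨q, by omega⟩
  have hs : ∀ (i : ℕ) (p : MvPolynomial (Fin n) k), (-1) ^ i * p = ((-1 : k) ^ i) • p := by
    intro i p
    rw [smul_eq_C_mul]; simp
  have h2 : ∀ p : MvPolynomial (Fin n) k, (2 : k) • p = 2 * p := by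
    intro p
    rw [smul_eq_C_mul, map_ofNat]
  set F : ℕ → MvPolynomial (Fin n) k := fun i => ((-1 : k) ^ i) • (var b i * var b (n + 2 - i))
    with hF
  have hsplit : Finset.Icc 3 (n - 1) =
      insert (q + 1) (Finset.Icc 3 q ∪ Finset.Icc (q + 2) (n - 1)) := by
    ext i
    simp only [Finset.mem_insert, Finset.mem_union, Finset.mem_Icc]
    omega
  have hrefl : ∑ i ∈ Finset.Icc (q + 2) (n - 1), F i = ∑ i ∈ Finset.Icc 3 q, F i := by
    refine Finset.sum_nbij' (fun i => n + 2 - i) (fun i => n + 2 - i) ?_ ?_ ?_ ?_ ?_ <;>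
      intro i hi <;> rw [Finset.mem_Icc] at hi
    · exact Finset.mem_Icc.mpr (by omega)
    · exact Finset.mem_Icc.mpr (by omega)
    · omega
    · omega
    · have h3 : n + 2 - (n + 2 - i) = i := by omega
      rw [hF]
      simp only
      rw [neg_one_pow_reflect hn (by omega), h3, mul_comm]
  have hT : quadTail b = F (q + 1) + 2 * ∑ i ∈ Finset.Icc 3 q, F i := by
    change ∑ i ∈ Finset.Icc 3 (n - 1), F i = _
    rw [hsplit, Finset.sum_insert, Finset.sum_union, hrefl, two_mul]
    · rw [Finset.disjoint_left]
      intro i hi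
      rw [Finset.mem_Icc] at hi ⊢
      omega
    · simp
  have hmid : F (q + 1) = (-1) ^ (q + 1) * var b (q + 1) ^ 2 := by
    rw [hs, hF]
    simp only
    rw [show n + 2 - (q + 1) = q + 1 by omega, sq]
  have hsum : ∑ i ∈ Finset.Icc 3 q, F i =
      ∑ i ∈ Finset.Icc 3 q, (-1) ^ i * (var b i * var b (n - i + 2)) := by
    refine Finset.sum_congr rfl fun i hi => ?_
    rw [Finset.mem_Icc] at hi
    rw [hs, hF, show n - i + 2 = n + 2 - i by omega]
  rw [hT, hmid, hsum, quadQ, h2]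
  ring

theorem quadQ_isHomogeneous {q : ℕ} (hq : 3 ≤ q) (hnq : n = 2 * q) :
    (quadQ b q).IsHomogeneous 2 := by
  rw [quadQ_eq b hq hnq, smul_eq_C_mul]
  have hm : ∀ {i j}, 1 ≤ i → i ≤ n → 1 ≤ j → j ≤ n → (var b i * var b j).IsHomogeneous 2 :=
    fun hi hin hj hjn => (var_isHomogeneous b hi hin).mul (var_isHomogeneous b hj hjn)
  refine ((hm le_rfl (by omega) (by omega) le_rfl).C_mul _).add
    (IsHomogeneous.sum _ _ _ fun i hi => ?_)
  rw [Finset.mem_Icc] at hi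
  rw [smul_eq_C_mul]
  exact (hm (by omega) (by omega) (by omega) (by omega)).C_mul _

/-- The two halves of the Leibniz rule agree after the reflection `i ↦ n + 2 - i`. -/
theorem derivation_quadQ {q : ℕ} (hq : 3 ≤ q) (hnq : n = 2 * q)
    (D : Derivation k (MvPolynomial (Fin n) k) (MvPolynomial (Fin n) k)) :
    D (quadQ b q) = (2 : k) • (var b 1 * D (var b n) + var b n * D (var b 1) +
      ∑ i ∈ Finset.Icc 3 (n - 1), ((-1 : k) ^ i) • (var b (n + 2 - i) * D (var b i))) := by
  have hn : Even n := ⟨q, by omega⟩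
  have h1 : D (quadTail b) = (2 : k) •
      ∑ i ∈ Finset.Icc 3 (n - 1), ((-1 : k) ^ i) • (var b (n + 2 - i) * D (var b i)) := by
    rw [quadTail, map_sum, two_smul]
    conv_rhs => lhs; rw [← sum_Icc_three_reflect]
    rw [← Finset.sum_add_distrib]
    refine Finset.sum_congr rfl fun i hi => ?_
    rw [Finset.mem_Icc] at hi
    have h3 : n + 2 - (n + 2 - i) = i := by omega
    rw [Derivation.map_smul, Derivation.leibniz, smul_eq_mul, smul_eq_mul, smul_add, h3,
      neg_one_pow_reflect hn (by omega)]
  rw [quadQ_eq b hq hnq, map_add, h1, Derivation.map_smul, Derivation.leibniz, smul_eq_mul,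
    smul_eq_mul, ← smul_add]

end QuadQ

/-! ### Two Casimirs of type `Q`: `xₙ` and `f` -/

section Center

open MvPolynomial

variable {k : Type*} [Field k] {L : Type*} [LieRing L] [LieAlgebra k L]
variable {n : ℕ} {b : Module.Basis (Fin n) k L}

namespace IsTypeQ

/-- For `j = 1` the terms cancel in pairs. For `2 ≤ j ≤ n - 2` only `i = n + 1 - j` contributes to
the sum, and it cancels `xₙ [xⱼ, x₁] = -xₙ xⱼ₊₁`. For `j ≥ n - 1` every term vanishes. -/
theorem poissonBracket_var_quadQ (h : IsTypeQ b) {q : ℕ} (hq : 3 ≤ q)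
    (hnq : n = 2 * q) {j : ℕ} (hj : 1 ≤ j) (hjn : j ≤ n) :
    poissonBracket b (var b j) (quadQ b q) = 0 := by
  have hn : Even n := ⟨q, by omega⟩
  have hD : ∀ {i}, 1 ≤ i → i ≤ n →
      hamiltonian b (var b j) (var b i) = toSym b ⁅vec b j, vec b i⁆ := fun hi hin => by
    rw [hamiltonian_apply, poissonBracket_var b hj hjn hi hin]
  rw [← hamiltonian_apply, derivation_quadQ b hq hnq]
  rw [hD le_rfl (by omega), hD (by omega) le_rfl]
  rw [← lie_skew (vec b j) (vec b n), h.lie_last (by omega), neg_zero, map_zero, mul_zero, zero_add]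
  refine smul_eq_zero_of_right _ ?_
  rcases eq_or_lt_of_le hj with rfl | hj1
  · rw [lie_self, map_zero, mul_zero, zero_add]
    have hz : hamiltonian b (var b 1) (var b (n - 1)) = 0 := by
      rw [hD (by omega) (by omega), h.lie_one_eq_zero (by omega) (by omega) (by omega), map_zero]
    have hs : Finset.Icc 3 (n - 1) = insert (n - 1) (Finset.Icc 3 (n - 2)) := by
      ext i
      simp only [Finset.mem_insert, Finset.mem_Icc]
      omega
    rw [hs, Finset.sum_insert (by simp; omega), hz, mul_zero, smul_zero, zero_add]
    have hD1 : ∀ i, 3 ≤ i → i ≤ n - 2 → hamiltonian b (var b 1) (var b i) = var b (i + 1) :=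
      fun i hi hin => by rw [hD (by omega) (by omega), h.lie_one (by omega) (by omega)]; rfl
    -- The terms at `i` and `n + 1 - i` have the same monomial and opposite signs; there is no fixed
    -- point, since `n + 1` is odd.
    refine Finset.sum_involution (fun i _ => n + 1 - i) ?_ ?_ ?_ ?_ <;> intro i hi <;>
      rw [Finset.mem_Icc] at hi
    · rw [hD1 i hi.1 hi.2, hD1 (n + 1 - i) (by omega) (by omega),
        show n + 2 - (n + 1 - i) = i + 1 by omega, show n + 1 - i + 1 = n + 2 - i by omega,
        mul_comm (var b (i + 1)), ← add_smul]
      refine smul_eq_zero_of_left ?_ _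
      rcases Nat.even_or_odd i with hi' | hi'
      · have : Odd (n + 1 - i) := by grind
        rw [hi'.neg_one_pow, this.neg_one_pow, add_neg_cancel]
      · have : Even (n + 1 - i) := by grind
        rw [hi'.neg_one_pow, this.neg_one_pow, neg_add_cancel]
    · omega
    · exact Finset.mem_Icc.mpr (by omega)
    · omega
  · have h0 : ∀ i ∈ Finset.Icc 3 (n - 1), i ≠ n + 1 - j →
        ((-1 : k) ^ i) • (var b (n + 2 - i) * hamiltonian b (var b j) (var b i)) = 0 := by
      intro i hi hij
      rw [Finset.mem_Icc] at hi
      rw [hD (by omega) (by omega), h.lie_eq_zero hj1 hjn (by omega) (by omega) (by omega),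
        map_zero, mul_zero, smul_zero]
    by_cases hj2 : j + 2 ≤ n
    · rw [← lie_skew (vec b j) (vec b 1), h.lie_one hj1 hj2,
        Finset.sum_eq_single (n + 1 - j) h0, hD (by omega) (by omega),
        h.lie_eq hn hj1 (by omega) (by omega),
        show n + 2 - (n + 1 - j) = j + 1 by omega, map_neg, map_smul, mul_smul_comm, smul_smul,
        ← pow_add, Even.neg_one_pow, one_smul]
      · change var b n * -var b (j + 1) + var b (j + 1) * var b n = 0
        ring
      · rw [show n + 1 - j + (j + 1) = n + 2 by omega]
        exact hn.add even_two
      · intro h1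
        exact absurd (Finset.mem_Icc.mpr (by omega)) h1
    · rw [← lie_skew, h.lie_one_eq_zero (by omega) hj1 hjn, neg_zero, map_zero, mul_zero, zero_add]
      refine Finset.sum_eq_zero fun i hi => h0 i hi ?_
      rw [Finset.mem_Icc] at hi
      omega

theorem quadQ_mem_poissonCenter (h : IsTypeQ b) {q : ℕ} (hq : 3 ≤ q) (hnq : n = 2 * q) :
    quadQ b q ∈ poissonCenter b :=
  mem_poissonCenter_of_X b fun i => by
    rw [X_eq_var b]
    exact h.poissonBracket_var_quadQ hq hnq (by omega) (by omega)

theorem var_last_mem_poissonCenter (h : IsTypeQ b) (hn : 4 ≤ n) :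
    var b n ∈ poissonCenter b :=
  mem_poissonCenter_of_X b fun i => by
    rw [X_eq_var b, poissonBracket_var b (by omega) (by omega) (by omega) le_rfl, ← lie_skew,
      h.lie_last hn, neg_zero, map_zero]

end IsTypeQ
end Center

/-! ### Replacing `x₁` by `f`, and division by `xₙ` in `k[xₙ, f]` -/

section Substitution

open MvPolynomial

variable {k : Type*} [Field k] {L : Type*} [LieRing L] [LieAlgebra k L]
variable {n : ℕ} (b : Module.Basis (Fin n) k L) (q : ℕ)

/-- The chain rule for a derivation that sees only one of the new coordinates `Φ (X i)`. -/
theorem derivation_algHom_apply {σ : Type*} (Φ : MvPolynomial σ k →ₐ[k] MvPolynomial σ k)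
    (D : Derivation k (MvPolynomial σ k) (MvPolynomial σ k)) {m : σ} {c : MvPolynomial σ k}
    (hm : D (Φ (X m)) = c) (h0 : ∀ i, i ≠ m → D (Φ (X i)) = 0) (p : MvPolynomial σ k) :
    D (Φ p) = Φ (pderiv m p) * c := by
  induction p using MvPolynomial.induction_on with
  | C a =>
    rw [pderiv_C, map_zero, zero_mul, ← algebraMap_eq, AlgHom.commutes, Derivation.map_algebraMap]
  | add p p' hp hp' => rw [map_add, map_add, map_add, map_add, hp, hp', add_mul]
  | mul_X p i hp =>
    rw [map_mul, Derivation.leibniz, Derivation.leibniz, hp, smul_eq_mul, smul_eq_mul, smul_eq_mul,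
      smul_eq_mul, map_add, map_mul, map_mul]
    by_cases him : i = m
    · subst him
      rw [hm, pderiv_X_self, map_one]
      ring
    · rw [h0 i him, pderiv_X_of_ne him, map_zero]
      ring

theorem notMem_vars_of_pderiv_eq_zero [CharZero k] {σ : Type*} {i : σ} {p : MvPolynomial σ k}
    (h : pderiv i p = 0) : i ∉ p.vars := by
  intro hi
  obtain ⟨d, hd, hid⟩ := (mem_vars_iff_mem_support i).mp hi
  have h1 := coeff_pderiv (i := i) p (d - Finsupp.single i 1)
  have hle : Finsupp.single i 1 ≤ d := by
    rw [Finsupp.single_le_iff]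
    exact Nat.one_le_iff_ne_zero.mpr (Finsupp.mem_support_iff.mp hid)
  rw [h, coeff_zero, tsub_add_cancel_of_le hle] at h1
  rcases mul_eq_zero.mp h1.symm with h2 | h2
  · exact mem_support_iff.mp hd h2
  · exact Nat.cast_add_one_ne_zero _ h2

/-- The endomorphism of `S(L)` that sends `x₁` to `quadQ` and fixes the other variables. -/
def substQ : MvPolynomial (Fin n) k →ₐ[k] MvPolynomial (Fin n) k :=
  aeval fun i => if (i : ℕ) = 0 then quadQ b q else X i

variable {q}

theorem substQ_var_one (hn : 1 ≤ n) : substQ b q (var b 1) = quadQ b q := by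
  rw [var_eq b le_rfl hn, substQ, aeval_X, if_pos rfl]

theorem substQ_var {i : ℕ} (hi : 2 ≤ i) (hin : i ≤ n) : substQ b q (var b i) = var b i := by
  rw [var_eq b (by omega) hin, substQ, aeval_X, if_neg (by simp; omega)]

theorem algHom_quadTail {A : Type*} [CommSemiring A] [Algebra k A]
    (Φ Φ' : MvPolynomial (Fin n) k →ₐ[k] A)
    (h : ∀ i, 2 ≤ i → i ≤ n → Φ (var b i) = Φ' (var b i)) :
    Φ (quadTail b) = Φ' (quadTail b) := by
  rw [quadTail, map_sum, map_sum]
  refine Finset.sum_congr rfl fun i hi => ?_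
  rw [Finset.mem_Icc] at hi
  rw [map_smul, map_smul, map_mul, map_mul, h i (by omega) (by omega), h _ (by omega) (by omega)]

theorem substQ_quadTail : substQ b q (quadTail b) = quadTail b :=
  algHom_quadTail b (substQ b q) (AlgHom.id k _) fun _ hi hin => substQ_var b hi hin

/-- Over the fraction field the substitution is undone by `x₁ ↦ (x₁ - quadTail) / (2 xₙ)`. -/
theorem substQ_injective [CharZero k] (hq : 3 ≤ q) (hnq : n = 2 * q) :
    Function.Injective (substQ b q) := by
  let K := FractionRing (MvPolynomial (Fin n) k)
  let ι : MvPolynomial (Fin n) k →ₐ[k] K := Algebra.algHom k (MvPolynomial (Fin n) k) K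
  have hι : Function.Injective ι := IsFractionRing.injective (MvPolynomial (Fin n) k) K
  let ψ : MvPolynomial (Fin n) k →ₐ[k] K := aeval fun i : Fin n =>
    if (i : ℕ) = 0 then (2 : k)⁻¹ • ((ι (var b 1) - ι (quadTail b)) / ι (var b n)) else ι (X i)
  have hψ1 : ψ (var b 1) = (2 : k)⁻¹ • ((ι (var b 1) - ι (quadTail b)) / ι (var b n)) := by
    conv_lhs => rw [var_eq b le_rfl (by omega)]
    exact (aeval_X _ _).trans (if_pos rfl)
  have hψ : ∀ i, 2 ≤ i → i ≤ n → ψ (var b i) = ι (var b i) := by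
    intro i hi hin
    rw [var_eq b (by omega) hin]
    exact (aeval_X _ _).trans (if_neg (by simp; omega))
  have hne : ι (var b n) ≠ 0 := by
    rw [Ne, map_eq_zero_iff ι hι, var_eq b (by omega) le_rfl]
    exact X_ne_zero _
  have hcomp : ψ.comp (substQ b q) = ι := by
    refine MvPolynomial.algHom_ext fun i => ?_
    rw [AlgHom.comp_apply, X_eq_var b]
    by_cases hi : (i : ℕ) = 0
    · rw [hi, zero_add, substQ_var_one b (by omega), quadQ_eq b hq hnq, map_add, map_smul, map_mul,
        algHom_quadTail b ψ ι hψ, hψ1, hψ n (by omega) le_rfl, smul_mul_assoc, smul_smul,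
        mul_inv_cancel₀ two_ne_zero, one_smul, div_mul_cancel₀ _ hne, sub_add_cancel]
    · rw [substQ_var b (by omega) (by omega), hψ _ (by omega) (by omega)]
  intro p p' hp
  apply hι
  rw [← hcomp, AlgHom.comp_apply, AlgHom.comp_apply, hp]

/-- Each factor `x₁` costs one `xₙ`, through `xₙ x₁ = (f - quadTail) / 2`. -/
theorem exists_pow_mul_mem_range_substQ [CharZero k] (hq : 3 ≤ q) (hnq : n = 2 * q)
    (g : MvPolynomial (Fin n) k) : ∃ (N : ℕ) (p : MvPolynomial (Fin n) k),
      var b n ^ N * g = substQ b q p := by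
  have hv : ∀ N : ℕ, substQ b q (var b n ^ N) = var b n ^ N := fun N => by
    rw [map_pow, substQ_var b (by omega) le_rfl]
  induction g using MvPolynomial.induction_on with
  | C a => exact ⟨0, C a, by rw [pow_zero, one_mul, ← algebraMap_eq, AlgHom.commutes]⟩
  | add g g' hg hg' =>
    obtain ⟨N, p, hp⟩ := hg
    obtain ⟨N', p', hp'⟩ := hg'
    refine ⟨N + N', var b n ^ N' * p + var b n ^ N * p', ?_⟩
    rw [map_add, map_mul, map_mul, hv, hv, ← hp, ← hp']
    ring
  | mul_X g i hg =>
    obtain ⟨N, p, hp⟩ := hg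
    rw [X_eq_var b]
    by_cases hi : (i : ℕ) = 0
    · refine ⟨N + 1, p * (2 : k)⁻¹ • (var b 1 - quadTail b), ?_⟩
      rw [hi, zero_add, map_mul, map_smul, map_sub, substQ_quadTail, substQ_var_one b (by omega),
        quadQ_eq b hq hnq, add_sub_cancel_right, smul_smul, inv_mul_cancel₀ two_ne_zero, one_smul,
        ← hp]
      ring
    · refine ⟨N, p * var b (i + 1), ?_⟩
      rw [map_mul, substQ_var b (by omega) (by omega), ← hp]
      ring

variable (q) in
/-- The homomorphism `k[y][z] → S(L)` with `y ↦ quadQ`, `z ↦ xₙ`. -/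
def centerHom : Polynomial (Polynomial k) →+* MvPolynomial (Fin n) k :=
  Polynomial.eval₂RingHom (Polynomial.aeval (quadQ b q)).toRingHom (var b n)

theorem centerHom_C (c : Polynomial k) :
    centerHom b q (Polynomial.C c) = Polynomial.aeval (quadQ b q) c := by
  rw [centerHom, Polynomial.coe_eval₂RingHom, Polynomial.eval₂_C]
  rfl

theorem centerHom_X : centerHom b q Polynomial.X = var b n := by
  rw [centerHom, Polynomial.coe_eval₂RingHom, Polynomial.eval₂_X]

theorem centerHom_mem_adjoin (P : Polynomial (Polynomial k)) :
    centerHom b q P ∈ Algebra.adjoin k {var b n, quadQ b q} := by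
  induction P using Polynomial.induction_on' with
  | add P P' hP hP' =>
    rw [map_add]
    exact add_mem hP hP'
  | monomial m c =>
    rw [← Polynomial.C_mul_X_pow_eq_monomial, map_mul, map_pow, centerHom_C, centerHom_X]
    refine mul_mem (Algebra.adjoin_mono (by simp) (Polynomial.aeval_mem_adjoin_singleton k _))
      (pow_mem (Algebra.subset_adjoin (by simp)) m)

/-- If `xₙ` divides `P(f, xₙ)`, specialization to `xₙ = 0` shows that the constant coefficient of
`P` in `z` vanishes, so a factor `z` can be removed from `P`. Induction on `N` removes them all. -/
theorem centerHom_mem_of_pow_mul (hq : 3 ≤ q) (hnq : n = 2 * q) (N : ℕ) :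
    ∀ (g : MvPolynomial (Fin n) k) (P : Polynomial (Polynomial k)),
      var b n ^ N * g = centerHom b q P → g ∈ Set.range (centerHom b q) := by
  -- Specializing all variables but `x_{q+1}` to zero sends `quadQ` to `± T²` and `xₙ` to `0`.
  let χ : MvPolynomial (Fin n) k →ₐ[k] Polynomial k :=
    aeval fun i : Fin n => if (i : ℕ) = q then Polynomial.X else 0
  have hχ : ∀ i, 1 ≤ i → i ≤ n → χ (var b i) = if i = q + 1 then Polynomial.X else 0 := by
    intro i hi hin
    rw [var_eq b hi hin]
    refine (aeval_X _ _).trans ?_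
    simp only
    split_ifs <;> first | rfl | omega
  have hχn : χ (var b n) = 0 := by rw [hχ n (by omega) le_rfl, if_neg (by omega)]
  have hχf : χ (quadQ b q) = ((-1 : k) ^ (q + 1)) • Polynomial.X ^ 2 := by
    rw [quadQ_eq b hq hnq, map_add, map_smul, map_mul, hχn, mul_zero, smul_zero, zero_add, quadTail,
      map_sum, Finset.sum_eq_single (q + 1)]
    · rw [map_smul, map_mul, hχ _ (by omega) (by omega), hχ _ (by omega) (by omega), if_pos rfl,
        if_pos (by omega), sq]
    · intro i hi hiq
      rw [Finset.mem_Icc] at hi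
      rw [map_smul, map_mul, hχ i (by omega) (by omega), if_neg hiq, zero_mul, smul_zero]
    · intro h
      exact absurd (Finset.mem_Icc.mpr (by omega)) h
  have hdiv : ∀ P : Polynomial (Polynomial k), χ (centerHom b q P) = 0 →
      centerHom b q P = centerHom b q P.divX * var b n := by
    intro P hP
    have h1 : centerHom b q P = centerHom b q P.divX * var b n +
        Polynomial.aeval (quadQ b q) (P.coeff 0) := by
      conv_lhs => rw [← Polynomial.divX_mul_X_add P]
      rw [map_add, map_mul, centerHom_X, centerHom_C]
    rw [h1, map_add, map_mul, hχn, mul_zero, zero_add, ← Polynomial.aeval_algHom_apply, hχf,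
      ← Polynomial.comp_eq_aeval, Polynomial.comp_eq_zero_iff] at hP
    have h2 : P.coeff 0 = 0 := by
      -- The alternative would make `± T²` a constant; its coefficient in degree 2 excludes this.
      refine hP.resolve_right fun h => ?_
      have h3 := congrArg (fun p => Polynomial.coeff p 2) h.2
      simp at h3
    rw [h1, h2, map_zero, add_zero]
  have hne : var b n ≠ 0 := by
    rw [var_eq b (by omega) le_rfl]
    exact X_ne_zero _
  induction N with
  | zero =>
    intro g P h
    exact ⟨P, by rw [← h, pow_zero, one_mul]⟩
  | succ N ih =>
    intro g P h
    refine ih g P.divX (mul_right_cancel₀ hne ?_)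
    rw [← hdiv P (by rw [← h, map_mul, map_pow, hχn, zero_pow (by omega), zero_mul]), ← h]
    ring

end Substitution

/-! ### The Poisson center of type `Q` and the complete subalgebra -/

section Center

open MvPolynomial

variable {k : Type*} [Field k] {L : Type*} [LieRing L] [LieAlgebra k L]
variable {n : ℕ} {b : Module.Basis (Fin n) k L}

namespace IsTypeQ

/-- The Poisson center in type `Q` is contained in `k[xₙ, f]`. -/
theorem poissonCenter_le [CharZero k] (h : IsTypeQ b) {q : ℕ} (hq : 3 ≤ q) (hnq : n = 2 * q) :
    poissonCenter b ≤ Algebra.adjoin k {var b n, quadQ b q} := by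
  intro g hg
  have hn : Even n := ⟨q, by omega⟩
  obtain ⟨N, p, hp⟩ := exists_pow_mul_mem_range_substQ b hq hnq g
  have hpc : substQ b q p ∈ poissonCenter b := by
    rw [← hp]
    exact mul_mem (pow_mem (h.var_last_mem_poissonCenter (by omega)) N) hg
  have hinj := substQ_injective b hq hnq
  have hvars : ∀ i ∈ p.vars, (i : ℕ) = 0 ∨ (i : ℕ) = n - 1 := by
    intro i hi
    by_contra! hi'
    refine notMem_vars_of_pderiv_eq_zero (hinj ?_) hi
    have hvn : ((-1 : k) ^ (n - i + 1)) • var b n ≠ 0 := by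
      rw [var_eq b (by omega) le_rfl]
      exact smul_ne_zero (pow_ne_zero _ (neg_ne_zero.mpr one_ne_zero)) (X_ne_zero _)
    -- The index `i` counts from zero, so `X i` is `xᵢ₊₁` and its partner is `xₙ₋ᵢ`. Bracketing with
    -- this partner kills `f` and every other `xⱼ` with `j ≥ 2`.
    have hD := derivation_algHom_apply (substQ b q) (hamiltonian b (var b (n - i))) (m := i)
      (c := ((-1 : k) ^ (n - i + 1)) • var b n) ?_ ?_ p
    · rw [hamiltonian_apply, poissonBracket_skew, hpc, neg_zero] at hD
      rw [map_zero]
      exact (mul_eq_zero.mp hD.symm).resolve_right hvn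
    · rw [X_eq_var b, substQ_var b (by omega) (by omega), hamiltonian_apply,
        poissonBracket_var b (by omega) (by omega) (by omega) (by omega),
        h.lie_eq hn (by omega) (by omega) (by omega), map_smul]
      rfl
    · intro j hj
      rw [X_eq_var b, hamiltonian_apply]
      by_cases hj0 : (j : ℕ) = 0
      · rw [hj0, zero_add, substQ_var_one b (by omega)]
        exact h.poissonBracket_var_quadQ hq hnq (by omega) (by omega)
      · have hij : (j : ℕ) ≠ i := fun h => hj (Fin.ext h)
        rw [substQ_var b (by omega) (by omega),
          poissonBracket_var b (by omega) (by omega) (by omega) (by omega),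
          h.lie_eq_zero (by omega) (by omega) (by omega) (by omega) (by omega), map_zero]
  -- Only `x₁` and `xₙ` occur in `p`, so the value of `V` on the remaining variables is immaterial.
  let V : MvPolynomial (Fin n) k →+* Polynomial (Polynomial k) :=
    eval₂Hom (Polynomial.C.comp Polynomial.C) fun i : Fin n =>
      if (i : ℕ) = 0 then Polynomial.C Polynomial.X else Polynomial.X
  have hV : substQ b q p = centerHom b q (V p) := by
    refine hom_congr_vars (f₁ := (substQ b q).toRingHom) (f₂ := (centerHom b q).comp V) ?_ ?_ rfl
    · refine RingHom.ext fun a => ?_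
      change substQ b q (C a) = centerHom b q (V (C a))
      rw [eval₂Hom_C, RingHom.comp_apply, centerHom_C, Polynomial.aeval_C, ← algebraMap_eq,
        AlgHom.commutes]
    · intro i hi _
      change substQ b q (X i) = centerHom b q (V (X i))
      rw [eval₂Hom_X']
      rcases hvars i hi with h0 | h0
      · rw [if_pos h0, centerHom_C, Polynomial.aeval_X, X_eq_var b, h0, zero_add,
          substQ_var_one b (by omega)]
      · rw [if_neg (by omega), centerHom_X, X_eq_var b, h0, Nat.sub_add_cancel (by omega),
          substQ_var b (by omega) le_rfl]
  obtain ⟨P, rfl⟩ := centerHom_mem_of_pow_mul b hq hnq N g (V p) (hp.trans hV)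
  exact centerHom_mem_adjoin b P

theorem symSub_sup_poissonCenter [CharZero k] (h : IsTypeQ b) {q : ℕ} (hq : 3 ≤ q) (hnq : n = 2 * q) :
    symSub b (Submodule.span k (vec b '' Set.Icc (q + 1) n)) ⊔ poissonCenter b =
      Algebra.adjoin k (var b '' Set.Icc (q + 1) n ∪ {quadQ b q}) := by
  rw [symSub_span_vec]
  refine le_antisymm (sup_le (Algebra.adjoin_mono Set.subset_union_left)
    ((h.poissonCenter_le hq hnq).trans (Algebra.adjoin_mono ?_))) (Algebra.adjoin_le ?_)
  · rintro x (rfl | rfl)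
    · exact Or.inl ⟨n, ⟨by omega, le_rfl⟩, rfl⟩
    · exact Or.inr rfl
  · rintro x (hx | rfl)
    · exact (le_sup_left : _ ≤ _ ⊔ poissonCenter b) (Algebra.subset_adjoin hx)
    · exact (le_sup_right : poissonCenter b ≤ _) (h.quadQ_mem_poissonCenter hq hnq)

/-- The generators are the images of `x₁, x_{q+1}, …, xₙ` under the injective substitution, hence `q
+ 1` independent elements. -/
theorem trdeg_adjoin [CharZero k] (h : IsTypeQ b) {q : ℕ} (hq : 3 ≤ q) (hnq : n = 2 * q) :
    Algebra.trdeg k (Algebra.adjoin k (var b '' Set.Icc (q + 1) n ∪ {quadQ b q})) =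
      (magicNumber k L : Cardinal) := by
  have hJ : insert 1 (Finset.Icc (q + 1) n) ⊆ Finset.Icc 1 n := by
    intro i hi
    simp only [Finset.mem_insert, Finset.mem_Icc] at hi ⊢
    omega
  have hai := (algebraicIndependent_var b hJ).map' (substQ_injective b hq hnq)
  have ht := trdeg_adjoin_of_algebraicIndependent hai
  have hr : Set.range (substQ b q ∘ fun i : (insert 1 (Finset.Icc (q + 1) n) : Finset ℕ) =>
      var b i) = var b '' Set.Icc (q + 1) n ∪ {quadQ b q} := by
    ext x
    constructor
    · rintro ⟨⟨i, hi⟩, rfl⟩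
      rcases Finset.mem_insert.mp hi with rfl | hi
      · exact Or.inr (substQ_var_one b (by omega))
      · rw [Finset.mem_Icc] at hi
        exact Or.inl ⟨i, hi, (substQ_var b (by omega) hi.2).symm⟩
    · rintro (⟨i, hi, rfl⟩ | rfl)
      · exact ⟨⟨i, Finset.mem_insert_of_mem (Finset.mem_Icc.mpr hi)⟩,
          substQ_var b (i := i) (Nat.le_trans (by omega) hi.1) hi.2⟩
      · exact ⟨⟨1, Finset.mem_insert_self _ _⟩, substQ_var_one b (by omega)⟩
  rw [hr] at ht
  rw [ht, h.magicNumber_eq hq hnq, Fintype.card_coe, Finset.card_insert_of_notMem, Nat.card_Icc]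
  · congr 1
    omega
  · rw [Finset.mem_Icc]
    omega

theorem isPoissonCommutative_adjoin (h : IsTypeQ b) {q : ℕ} (hq : 3 ≤ q) (hnq : n = 2 * q) :
    IsPoissonCommutative b (Algebra.adjoin k (var b '' Set.Icc (q + 1) n ∪ {quadQ b q})) := by
  have hf := h.quadQ_mem_poissonCenter hq hnq
  refine Filiform.isPoissonCommutative_adjoin b ?_
  rintro x (hx | rfl) y (hy | rfl)
  · exact poissonBracket_var_eq_zero b (by omega) (h.lie_upper hnq) x hx y hy
  · rw [poissonBracket_skew, hf, neg_zero]
  · exact hf y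
  · exact hf _

end IsTypeQ

theorem typeQ_conclusion [CharZero k] (b : Module.Basis (Fin n) k L) {q : ℕ} (hq : 3 ≤ q) (hnq : n = 2 * q)
    (h : IsTypeQ b) :
    RProperty k L ∧
      maxAbelianDim k L = n / 2 ∧ MilovanovHolds b ∧
      ∃ H : LieSubalgebra k L,
        H.toSubmodule = Submodule.span k (vec b '' Set.Icc (q + 1) n) ∧
        IsLieAbelian H ∧ Module.finrank k H + 1 = magicNumber k L ∧
        symSub b H.toSubmodule ⊔ poissonCenter b =
          Algebra.adjoin k (var b '' Set.Icc (q + 1) n ∪ {quadQ b q}) ∧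
        (quadQ b q).IsHomogeneous 2 ∧
        IsCompletePoissonCommutative b (symSub b H.toSubmodule ⊔ poissonCenter b) ∧
        IsGeneratedInDegreeLETwo (symSub b H.toSubmodule ⊔ poissonCenter b) := by
  have hcomm := lie_vec_eq_zero b (h.lie_upper hnq)
  have hH := isLieAbelian_commutingSpan (k := k) _ hcomm
  have hd : Module.finrank k (commutingSpan (k := k) _ hcomm) = q :=
    (finrank_span_vec b (q + 1) (by omega)).trans (by omega)
  have hc : Module.finrank k (commutingSpan (k := k) _ hcomm) + 1 = magicNumber k L := by
    rw [hd, h.magicNumber_eq hq hnq]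
  have hsup : symSub b (commutingSpan (k := k) _ hcomm).toSubmodule ⊔ poissonCenter b =
      Algebra.adjoin k (var b '' Set.Icc (q + 1) n ∪ {quadQ b q}) :=
    h.symSub_sup_poissonCenter hq hnq
  have hcomplete : IsCompletePoissonCommutative b
      (Algebra.adjoin k (var b '' Set.Icc (q + 1) n ∪ {quadQ b q})) :=
    ⟨h.isPoissonCommutative_adjoin hq hnq, h.trdeg_adjoin hq hnq⟩
  have hgen : IsGeneratedInDegreeLETwo
      (Algebra.adjoin k (var b '' Set.Icc (q + 1) n ∪ {quadQ b q})) := by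
    refine ⟨_, ?_, rfl⟩
    rintro x (⟨i, hi, rfl⟩ | rfl)
    · exact (var_isHomogeneous b (by have := hi.1; omega) hi.2).totalDegree_le.trans one_le_two
    · exact (quadQ_isHomogeneous b hq hnq).totalDegree_le
  have hα := maxAbelianDim_eq _ hH fun A hA => (h.finrank_le_of_abelian hq hnq A hA).trans hd.ge
  refine ⟨Or.inr ⟨_, hH, hc⟩, by omega, ⟨_, hcomplete, hgen⟩, _, rfl, hH, hc, hsup,
    quadQ_isHomogeneous b hq hnq, ?_, ?_⟩
  · rw [hsup]; exact hcomplete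
  · rw [hsup]; exact hgen

end Center

end Filiform

end

theorem theorem8p6 {k : Type*} [Field k] [IsAlgClosed k] [CharZero k]
    {L : Type*} [LieRing L] [LieAlgebra k L] {n : ℕ} (b : Module.Basis (Fin n) k L) :
    (3 ≤ n → Filiform.IsTypeL b →
      Filiform.RProperty k L ∧ Filiform.HasCommutativePolarization k L ∧
      Filiform.maxAbelianDim k L = n - 1 ∧ Filiform.MilovanovHolds b) ∧
    (∀ q : ℕ, 3 ≤ q → n = 2 * q → Filiform.IsTypeQ b →
      Filiform.RProperty k L ∧
      Filiform.maxAbelianDim k L = n / 2 ∧ Filiform.MilovanovHolds b ∧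
      ∃ H : LieSubalgebra k L,
        H.toSubmodule = Submodule.span k (Filiform.vec b '' Set.Icc (q + 1) n) ∧
        IsLieAbelian H ∧ Module.finrank k H + 1 = Filiform.magicNumber k L ∧
        Filiform.symSub b H.toSubmodule ⊔ Filiform.poissonCenter b =
          Algebra.adjoin k
            (Filiform.var b '' Set.Icc (q + 1) n ∪ {Filiform.quadQ b q}) ∧
        (Filiform.quadQ b q).IsHomogeneous 2 ∧
        Filiform.IsCompletePoissonCommutative b
          (Filiform.symSub b H.toSubmodule ⊔ Filiform.poissonCenter b) ∧
        Filiform.IsGeneratedInDegreeLETwo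
          (Filiform.symSub b H.toSubmodule ⊔ Filiform.poissonCenter b)) ∧
    (5 ≤ n → Filiform.IsTypeR b →
      Filiform.RProperty k L ∧ Filiform.HasCommutativePolarization k L ∧
      Filiform.maxAbelianDim k L = n - 2 ∧ Filiform.MilovanovHolds b) ∧
    (3 ≤ n → Filiform.IsTypeW b →
      Filiform.RProperty k L ∧ Filiform.HasCommutativePolarization k L ∧
      Filiform.maxAbelianDim k L = (n + 2) / 2 ∧ Filiform.MilovanovHolds b) := by
  exact ⟨Filiform.typeL_conclusion b, fun _ => Filiform.typeQ_conclusion b,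
    Filiform.typeR_conclusion b, Filiform.typeW_conclusion b⟩
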